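/- Let $\Theta\subseteq(0,\infty)$ have non-empty interior. For $\vartheta\in\Theta$ let $X_t=\sum_{i=1}^{N_t}\varepsilon_i$, $t\ge 0$, where $(N_t)$ is a homogeneous Poisson process with intensity $\vartheta$ and the $\varepsilon_i$ are i.i.d. with $P(\varepsilon_i=1)=P(\varepsilon_i=-1)=\tfrac12$, independent of $(N_t)$. For $0<\Delta_T\le T$ let $\mathbb P_\vartheta^{T,\Delta_T}$ be the law on $\mathbb Z^{\lfloor T/\Delta_T\rfloor}$ of $\boldsymbol X=(X_{\Delta_T},X_{2\Delta_T},\dots,X_{\lfloor T/\Delta_T\rfloor\Delta_T})$, and let $\mathcal E^{T,\Delta_T}=\{\mathbb P_\vartheta^{T,\Delta_T},\ \vartheta\in\Theta\}$. For a normalisation $I_T>0$, the family $(\mathcal E^{T,\Delta_T})_{T>0}$ is called LAN at $\vartheta\in\Theta$ with information $I_T$ if there are statistics $\xi_T=\xi_T(\boldsymbol X)$, not depending on $v$, with $\xi_T\to\mathcal N(0,1)$ in distribution under $\mathbb P_\vartheta^{T,\Delta_T}$ as $T\to\infty$, such that for every $v\in\mathbb R$ and all $T>0$ with $\vartheta+vI_T^{-1/2}\in\Theta$,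 $$\frac{d\mathbb P^{T,\Delta_T}_{\vartheta+vI_T^{-1/2}}}{d\mathbb P^{T,\Delta_T}_{\vartheta}}(\boldsymbol X)=\exp\Big(v\,\xi_T-\tfrac12v^2+r_T\Big)\qquad \mathbb P_\vartheta^{T,\Delta_T}\text{-almost surely},$$ where $r_T=r_T(v)\to0$ in probability under $\mathbb P_\vartheta^{T,\Delta_T}$ as $T\to\infty$ along these $T$. Theorem (the macroscopic case). Assume that, as $T\to\infty$, $\Delta_T\to\infty$, $T/\Delta_T\to\infty$ and $T/\Delta_T^{1+\frac14}=o\big((\log(T/\Delta_T))^{-\frac14}\big)$. Then at every $\vartheta\in\Theta$ the family $(\mathcal E^{T,\Delta_T})_{T>0}$ is LAN with information $$I_{T,\infty}(\vartheta)=\frac{T\Delta_T^{-1}}{2\vartheta^2},$$ and it is also LAN at $\vartheta$ with any information $I_T>0$ such that $I_T/I_{T,\infty}(\vartheta)\to1$ as $T\to\infty$. -/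

import Mathlib

open MeasureTheory ProbabilityTheory Filter Topology Asymptotics
open scoped NNReal ENNReal BoundedContinuousFunction

noncomputable section

/-- `N` is a homogeneous Poisson process with intensity `ϑ` on the probability space `(Ω, P)`:
it starts at `0`, its paths are nondecreasing and right-continuous, its increments over disjoint
intervals are independent, and `N t - N s` is Poisson distributed with parameter `ϑ (t - s)`.
(The subtraction in `ℕ` is not truncated almost surely, as the paths are nondecreasing.) -/
structure IsPoissonProcess {Ω : Type*} [MeasurableSpace Ω] (ϑ : ℝ) (N : ℝ≥0 → Ω → ℕ)
    (P : Measure Ω) : Prop where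
  measurable : ∀ t, Measurable (N t)
  start_zero : ∀ᵐ ω ∂P, N 0 ω = 0
  monotone_path : ∀ᵐ ω ∂P, Monotone fun t => N t ω
  rightContinuous_path : ∀ᵐ ω ∂P, ∀ t, ContinuousWithinAt (fun s => N s ω) (Set.Ici t) t
  indep_increments : HasIndepIncrements N P
  increment_law : ∀ s t : ℝ≥0, s ≤ t →
    P.map (fun ω => N t ω - N s ω) = poissonMeasure (ϑ.toNNReal * (t - s))

/-- `ε 0, ε 1, …` are independent symmetric Bernoulli variables with values in `{-1, 1}`. -/
structure IsSymmetricBernoulliSequence {Ω : Type*} [MeasurableSpace Ω] (ε : ℕ → Ω → ℤ)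
    (P : Measure Ω) : Prop where
  measurable : ∀ i, Measurable (ε i)
  prob_one : ∀ i, P {ω | ε i ω = 1} = 1 / 2
  prob_neg_one : ∀ i, P {ω | ε i ω = -1} = 1 / 2
  indep : iIndepFun ε P

/-- `X` is a compound Poisson process with intensity `ϑ` and symmetric Bernoulli jumps, started
at `0`: `X_t` is the sum of the first `N_t` terms of a symmetric Bernoulli sequence `ε`, where `N`
is a Poisson process with intensity `ϑ` and the process `N` is independent of the sequence `ε`. -/
def IsBernoulliCompoundPoisson {Ω : Type*} [MeasurableSpace Ω] (ϑ : ℝ) (X : ℝ≥0 → Ω → ℤ)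
    (P : Measure Ω) : Prop :=
  ∃ (N : ℝ≥0 → Ω → ℕ) (ε : ℕ → Ω → ℤ),
    IsPoissonProcess ϑ N P ∧ IsSymmetricBernoulliSequence ε P ∧
    IndepFun (fun ω t => N t ω) (fun ω i => ε i ω) P ∧
    ∀ t ω, X t ω = ∑ i ∈ Finset.range (N t ω), ε i ω

/-- The law of the discrete observation `(X_Δ, X_{2Δ}, …, X_{nΔ})`, with `n = ⌊T / Δ⌋`. -/
def observationLaw {Ω : Type*} [MeasurableSpace Ω] (P : Measure Ω) (X : ℝ≥0 → Ω → ℤ)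
    (T Δ : ℝ) : Measure (Fin ⌊T / Δ⌋₊ → ℤ) :=
  P.map fun ω i => X (((i : ℝ) + 1) * Δ).toNNReal ω

/-- Local asymptotic normality, as `T → ∞`, at the point `ϑ` and with normalisation (information)
`I T`, of the statistical experiments `{Q T ϑ', ϑ' ∈ Θ}`, `T > 0`, on the sample spaces `𝒳 T`.
There is a central sequence `ξ`, which does not depend on the local parameter `v`, that converges
in distribution to `N(0,1)` under `Q T ϑ`. For every `v`, at all those `T` for which the local
alternative `ϑ + v / √(I T)` belongs to `Θ`, the likelihood ratio is `exp (v ξ - v² / 2 + r)`, and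
the remainder `r` tends to `0` in probability under `Q T ϑ` along these `T`. -/
def IsLANAt {𝒳 : ℝ → Type*} [∀ T, MeasurableSpace (𝒳 T)] (Q : ∀ T, ℝ → Measure (𝒳 T))
    (Θ : Set ℝ) (I : ℝ → ℝ) (ϑ : ℝ) : Prop :=
  (∀ T > 0, 0 < I T) ∧
  ∃ ξ : ∀ T, 𝒳 T → ℝ, (∀ T, Measurable (ξ T)) ∧
    (∀ g : ℝ →ᵇ ℝ, Tendsto (fun T => ∫ x, g (ξ T x) ∂(Q T ϑ)) atTop
      (𝓝 (∫ y, g y ∂(gaussianReal 0 1)))) ∧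
    ∀ v : ℝ, ∃ r : ∀ T, 𝒳 T → ℝ, (∀ T, Measurable (r T)) ∧
      (∀ T > 0, ϑ + v / √(I T) ∈ Θ →
        ∀ᵐ x ∂(Q T ϑ), ((Q T (ϑ + v / √(I T))).rnDeriv (Q T ϑ) x).toReal
          = Real.exp (v * ξ T x - v ^ 2 / 2 + r T x)) ∧
      ∀ δ > 0, Tendsto (fun T => Q T ϑ {x | δ < |r T x|})
        (atTop ⊓ 𝓟 {T | ϑ + v / √(I T) ∈ Θ}) (𝓝 0)

/-- The macroscopic information `T Δ_T⁻¹ / (2 ϑ²)`. -/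
def macroInformation (Δ : ℝ → ℝ) (ϑ T : ℝ) : ℝ := T * (Δ T)⁻¹ / (2 * ϑ ^ 2)

end

/-! Passing from positions to increments is injective, so the experiment is that of `n = ⌊T / Δ⌋`
independent increments whose law `incrLaw l`, `l = ϑ Δ`, is a Poisson mixture of simple random
walks. As `l → ∞` this law resembles the centered Gaussian law of variance `l`, a scale family in
which the log-likelihood ratio between variances `(1 + h) l` and `l` is affine in the sum of the
squared increments. The central sequence is therefore `score`, the standardised sum of squares.

The local limit theorem comes from Fourier inversion: the relative error of the Gaussian density at
`y` is at most `500 / l * exp (y² / (2l))` (`abs_incrProb_div_gaussDensity_sub_one_le`). A Chernoff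
bound and a union bound show that with probability tending to `1` all squared increments are below
`5 l log n`; there each logarithm is off by `O(n³ / l)`, and the whole log-likelihood ratio by `O(n⁴
/ l)`. The rate assumption makes this vanish, since `(T / Δ^(5/4))⁴ = (T / Δ)⁴ / Δ`.

In the Gaussian part, `h = v / (ϑ √I)` satisfies `h √n → v √2`. The coefficient of `score` then
tends to `v` and the deterministic term to `-v² / 2`; Chebyshev's inequality controls the error in
the coefficient. Asymptotic normality of `score` under the true increment law, not its Gaussian
approximation, follows from characteristic functions and a uniform third moment bound. -/

/-! ### Simple symmetric random walk -/

/-- The probability that the simple symmetric random walk is at `y` after `a` steps. -/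
noncomputable def walkProb : ℕ → ℤ → ℝ
  | 0, y => if y = 0 then 1 else 0
  | a + 1, y => (walkProb a (y - 1) + walkProb a (y + 1)) / 2

lemma walkProb_nonneg (a : ℕ) (y : ℤ) : 0 ≤ walkProb a y := by
  induction a generalizing y with
  | zero => simp only [walkProb]; split_ifs <;> norm_num
  | succ a ih => have := ih (y - 1); have := ih (y + 1); simp only [walkProb]; linarith

lemma walkProb_le_one (a : ℕ) (y : ℤ) : walkProb a y ≤ 1 := by
  induction a generalizing y with
  | zero => simp only [walkProb]; split_ifs <;> norm_num
  | succ a ih => have := ih (y - 1); have := ih (y + 1); simp only [walkProb]; linarith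

lemma walkProb_natAbs_pos (a : ℕ) (y : ℤ) (h : y.natAbs = a) : 0 < walkProb a y := by
  induction a generalizing y with
  | zero => simp [walkProb, Int.natAbs_eq_zero.1 h]
  | succ a ih =>
    have h1 := walkProb_nonneg a (y - 1)
    have h2 := walkProb_nonneg a (y + 1)
    simp only [walkProb]
    rcases lt_or_ge 0 y with hy | hy
    · have := ih (y - 1) (by omega)
      linarith
    · have := ih (y + 1) (by omega)
      linarith

lemma walkProb_eq_zero (a : ℕ) (y : ℤ) (h : a < y.natAbs) : walkProb a y = 0 := by
  induction a generalizing y with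
  | zero => simp only [walkProb]; rw [if_neg]; rintro rfl; simp at h
  | succ a ih =>
    simp only [walkProb]
    rw [ih _ (by omega), ih _ (by omega)]
    norm_num

lemma summable_walkProb_mul (a : ℕ) (g : ℤ → ℝ) : Summable fun y => walkProb a y * g y := by
  refine summable_of_ne_finset_zero (s := Finset.Icc (-(a : ℤ)) a) fun y hy => ?_
  rw [walkProb_eq_zero, zero_mul]
  simp only [Finset.mem_Icc] at hy
  omega

/-- The expectation of `g` at the position of the simple symmetric random walk after `a` steps. -/
noncomputable def walkMean (a : ℕ) (g : ℤ → ℝ) : ℝ := ∑' y, walkProb a y * g y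

lemma walkMean_zero (g : ℤ → ℝ) : walkMean 0 g = g 0 := by
  rw [walkMean, tsum_eq_single 0]
  · simp [walkProb]
  · intro y hy; simp [walkProb, hy]

lemma walkMean_add (a : ℕ) (g h : ℤ → ℝ) :
    walkMean a (fun y => g y + h y) = walkMean a g + walkMean a h := by
  simp only [walkMean, mul_add]
  exact (summable_walkProb_mul a g).tsum_add (summable_walkProb_mul a h)

lemma walkMean_const_mul (a : ℕ) (c : ℝ) (g : ℤ → ℝ) :
    walkMean a (fun y => c * g y) = c * walkMean a g := by
  simp only [walkMean, ← tsum_mul_left]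
  congr 1; ext y; ring

/-- Shifting the summation index moves the one-step average from the point probabilities to the test
function. Every moment below then follows by induction on the number of steps. -/
lemma walkMean_succ (a : ℕ) (g : ℤ → ℝ) :
    walkMean (a + 1) g = walkMean a fun y => (g (y + 1) + g (y - 1)) / 2 := by
  have s1 := summable_walkProb_mul a fun y => g (y + 1) / 2
  have s2 := summable_walkProb_mul a fun y => g (y - 1) / 2
  have e1 : ∑' y, walkProb a (y - 1) * (g y / 2) = ∑' y, walkProb a y * (g (y + 1) / 2) := by
    rw [← (Equiv.subRight (1 : ℤ)).tsum_eq fun y => walkProb a y * (g (y + 1) / 2)]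
    simp
  have e2 : ∑' y, walkProb a (y + 1) * (g y / 2) = ∑' y, walkProb a y * (g (y - 1) / 2) := by
    rw [← (Equiv.addRight (1 : ℤ)).tsum_eq fun y => walkProb a y * (g (y - 1) / 2)]
    simp
  have t1 : Summable fun y => walkProb a (y - 1) * (g y / 2) := by
    rw [← (Equiv.subRight (1 : ℤ)).summable_iff] at s1
    refine s1.congr fun y => ?_
    simp
  have t2 : Summable fun y => walkProb a (y + 1) * (g y / 2) := by
    rw [← (Equiv.addRight (1 : ℤ)).summable_iff] at s2
    refine s2.congr fun y => ?_
    simp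
  calc walkMean (a + 1) g
      = ∑' y, (walkProb a (y - 1) * (g y / 2) + walkProb a (y + 1) * (g y / 2)) := by
        simp only [walkMean, walkProb]; congr 1; ext y; ring
    _ = ∑' y, (walkProb a y * (g (y + 1) / 2) + walkProb a y * (g (y - 1) / 2)) := by
        rw [t1.tsum_add t2, e1, e2, s1.tsum_add s2]
    _ = _ := by simp only [walkMean]; congr 1; ext y; ring

lemma walkMean_one (a : ℕ) : walkMean a (fun _ => 1) = 1 := by
  induction a with
  | zero => simp [walkMean_zero]
  | succ a ih => rw [walkMean_succ]; norm_num [ih]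

/-- By the addition formulas, `y ↦ cosh (s y)` is an eigenfunction of the one-step average with
eigenvalue `cosh s`. -/
lemma walkMean_cosh (s : ℝ) (a : ℕ) :
    walkMean a (fun y => Real.cosh (s * y)) = Real.cosh s ^ a := by
  induction a with
  | zero => simp [walkMean_zero]
  | succ a ih =>
    rw [walkMean_succ, pow_succ', ← ih, ← walkMean_const_mul]
    congr 1; ext y
    push_cast
    rw [mul_add, mul_sub, mul_one, Real.cosh_add, Real.cosh_sub]
    ring

lemma walkMean_sq (a : ℕ) : walkMean a (fun y => (y : ℝ) ^ 2) = a := by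
  induction a with
  | zero => simp [walkMean_zero]
  | succ a ih =>
    rw [walkMean_succ]
    have : (fun y : ℤ => (((y + 1 : ℤ) : ℝ) ^ 2 + ((y - 1 : ℤ) : ℝ) ^ 2) / 2)
        = fun y : ℤ => (y : ℝ) ^ 2 + 1 := by
      ext y; push_cast; ring
    rw [this, walkMean_add, walkMean_one, ih]
    push_cast; ring

lemma walkMean_pow_four (a : ℕ) : walkMean a (fun y => (y : ℝ) ^ 4) = 3 * a ^ 2 - 2 * a := by
  induction a with
  | zero => simp [walkMean_zero]
  | succ a ih =>
    rw [walkMean_succ]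
    have : (fun y : ℤ => (((y + 1 : ℤ) : ℝ) ^ 4 + ((y - 1 : ℤ) : ℝ) ^ 4) / 2)
        = fun y : ℤ => ((y : ℝ) ^ 4 + 6 * (y : ℝ) ^ 2) + 1 := by
      ext y; push_cast; ring
    rw [this, walkMean_add, walkMean_add, walkMean_const_mul, walkMean_one, walkMean_sq, ih]
    push_cast; ring

/-! ### Poisson mixture of random walks: the law of one increment -/

/-- The weight `e⁻ˡ lᵃ / a!` of the Poisson distribution. -/
noncomputable def poissonWeight (l : ℝ) (a : ℕ) : ℝ := Real.exp (-l) * l ^ a / a.factorial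

lemma poissonWeight_pos {l : ℝ} (hl : 0 < l) (a : ℕ) : 0 < poissonWeight l a := by
  unfold poissonWeight; positivity

lemma poissonWeight_nonneg {l : ℝ} (hl : 0 ≤ l) (a : ℕ) : 0 ≤ poissonWeight l a := by
  unfold poissonWeight; positivity

lemma hasSum_poissonWeight_mul_pow (l c : ℝ) :
    HasSum (fun a => poissonWeight l a * c ^ a) (Real.exp (l * (c - 1))) := by
  have h := (NormedSpace.expSeries_div_hasSum_exp (l * c)).mul_left (Real.exp (-l))
  rw [← Real.exp_eq_exp_ℝ, ← Real.exp_add] at h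
  convert! h using 1
  · ext a; simp only [poissonWeight, mul_pow]; ring
  · congr 1; ring

lemma hasSum_poissonWeight (l : ℝ) : HasSum (poissonWeight l) 1 := by
  simpa using hasSum_poissonWeight_mul_pow l 1

lemma poissonWeight_succ (l : ℝ) (a : ℕ) :
    poissonWeight l (a + 1) * ((a + 1 : ℕ) : ℝ) = l * poissonWeight l a := by
  unfold poissonWeight
  rw [Nat.factorial_succ]
  have : (a.factorial : ℝ) ≠ 0 := by positivity
  push_cast
  field_simp
  ring

lemma hasSum_poissonWeight_mul_self (l : ℝ) : HasSum (fun a => poissonWeight l a * a) l := by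
  rw [← hasSum_nat_add_iff' 1]
  simp only [poissonWeight_succ]
  simpa using (hasSum_poissonWeight l).mul_left l

lemma hasSum_poissonWeight_mul_sq (l : ℝ) :
    HasSum (fun a => poissonWeight l a * (a : ℝ) ^ 2) (l ^ 2 + l) := by
  rw [← hasSum_nat_add_iff' 1]
  have := ((hasSum_poissonWeight_mul_self l).add (hasSum_poissonWeight l)).mul_left l
  convert! this using 1
  · ext a
    rw [pow_two, ← mul_assoc, poissonWeight_succ]
    push_cast; ring
  · simp; ring

/-- The probability that an increment of the compound Poisson process, over an interval on which
the expected number of jumps is `l`, is equal to `y`. -/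
noncomputable def incrProb (l : ℝ) (y : ℤ) : ℝ := ∑' a, poissonWeight l a * walkProb a y

lemma summable_incrProb {l : ℝ} (hl : 0 ≤ l) (y : ℤ) :
    Summable fun a => poissonWeight l a * walkProb a y := by
  refine Summable.of_nonneg_of_le (fun a => ?_) (fun a => ?_) (hasSum_poissonWeight l).summable
  · exact mul_nonneg (poissonWeight_nonneg hl a) (walkProb_nonneg a y)
  · exact mul_le_of_le_one_right (poissonWeight_nonneg hl a) (walkProb_le_one a y)

lemma incrProb_pos {l : ℝ} (hl : 0 < l) (y : ℤ) : 0 < incrProb l y :=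
  (summable_incrProb hl.le y).tsum_pos
    (fun a => mul_nonneg (poissonWeight_nonneg hl.le a) (walkProb_nonneg a y)) y.natAbs
    (mul_pos (poissonWeight_pos hl _) (walkProb_natAbs_pos _ y rfl))

lemma incrProb_nonneg {l : ℝ} (hl : 0 ≤ l) (y : ℤ) : 0 ≤ incrProb l y :=
  tsum_nonneg fun a => mul_nonneg (poissonWeight_nonneg hl a) (walkProb_nonneg a y)

lemma ofReal_incrProb {l : ℝ} (hl : 0 ≤ l) (y : ℤ) :
    ENNReal.ofReal (incrProb l y)
      = ∑' a, ENNReal.ofReal (poissonWeight l a) * ENNReal.ofReal (walkProb a y) := by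
  rw [incrProb, ENNReal.ofReal_tsum_of_nonneg
    (fun a => mul_nonneg (poissonWeight_nonneg hl a) (walkProb_nonneg a y)) (summable_incrProb hl y)]
  congr 1; ext a
  rw [ENNReal.ofReal_mul (poissonWeight_nonneg hl a)]

/-- The law of an increment of the compound Poisson process, over an interval on which
the expected number of jumps is `l`. -/
noncomputable def incrLaw (l : ℝ) : Measure ℤ :=
  Measure.sum fun y => ENNReal.ofReal (incrProb l y) • Measure.dirac y

lemma incrLaw_singleton (l : ℝ) (y : ℤ) : incrLaw l {y} = ENNReal.ofReal (incrProb l y) := by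
  rw [incrLaw, Measure.sum_smul_dirac_singleton]

/-- Conditioning on the number of jumps: for nonnegative `g`, Tonelli interchanges the sums over
positions and over jump counts. Summability of the conditional means thus yields both integrability
and the value of the integral. -/
lemma lintegral_incrLaw {l : ℝ} (hl : 0 ≤ l) {g : ℤ → ℝ} (hg : ∀ y, 0 ≤ g y) {S : ℝ}
    (hS : HasSum (fun a => poissonWeight l a * walkMean a g) S) :
    ∫⁻ y, ENNReal.ofReal (g y) ∂(incrLaw l) = ENNReal.ofReal S := by
  have hm : ∀ a, 0 ≤ walkMean a g := fun a =>
    tsum_nonneg fun y => mul_nonneg (walkProb_nonneg a y) (hg y)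
  rw [incrLaw, lintegral_sum_measure]
  simp only [lintegral_smul_measure, lintegral_dirac, smul_eq_mul, ofReal_incrProb hl,
    ← ENNReal.tsum_mul_right]
  rw [ENNReal.tsum_comm, ← hS.tsum_eq, ENNReal.ofReal_tsum_of_nonneg
    (fun a => mul_nonneg (poissonWeight_nonneg hl a) (hm a)) hS.summable]
  congr 1; ext a
  rw [ENNReal.ofReal_mul (poissonWeight_nonneg hl a), walkMean, ENNReal.ofReal_tsum_of_nonneg
    (fun y => mul_nonneg (walkProb_nonneg a y) (hg y)) (summable_walkProb_mul a g),
    ← ENNReal.tsum_mul_left]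
  congr 1; ext y
  rw [ENNReal.ofReal_mul (walkProb_nonneg a y), mul_assoc]

lemma isProbabilityMeasure_incrLaw {l : ℝ} (hl : 0 ≤ l) : IsProbabilityMeasure (incrLaw l) := by
  constructor
  have := lintegral_incrLaw hl (g := fun _ => 1) (S := 1) (fun _ => zero_le_one)
    (by simpa [walkMean_one] using hasSum_poissonWeight l)
  simpa using this

lemma integrable_incrLaw {l : ℝ} (hl : 0 ≤ l) {g : ℤ → ℝ} (hg : ∀ y, 0 ≤ g y) {S : ℝ}
    (hS : HasSum (fun a => poissonWeight l a * walkMean a g) S) : Integrable g (incrLaw l) := by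
  refine ⟨Measurable.of_discrete.aestronglyMeasurable, ?_⟩
  rw [hasFiniteIntegral_iff_ofReal (Eventually.of_forall hg), lintegral_incrLaw hl hg hS]
  exact ENNReal.ofReal_lt_top

lemma integral_incrLaw {l : ℝ} (hl : 0 ≤ l) {g : ℤ → ℝ} (hg : ∀ y, 0 ≤ g y) {S : ℝ}
    (hS : HasSum (fun a => poissonWeight l a * walkMean a g) S) : ∫ y, g y ∂(incrLaw l) = S := by
  rw [integral_eq_lintegral_of_nonneg_ae (Eventually.of_forall hg)
    Measurable.of_discrete.aestronglyMeasurable, lintegral_incrLaw hl hg hS, ENNReal.toReal_ofReal]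
  refine hS.nonneg fun a => mul_nonneg (poissonWeight_nonneg hl a) ?_
  exact tsum_nonneg fun y => mul_nonneg (walkProb_nonneg a y) (hg y)

lemma hasSum_walkMean_cosh (l s : ℝ) :
    HasSum (fun a => poissonWeight l a * walkMean a fun y => Real.cosh (s * y))
      (Real.exp (l * (Real.cosh s - 1))) := by
  simp only [walkMean_cosh]
  exact hasSum_poissonWeight_mul_pow l _

lemma hasSum_walkMean_sq (l : ℝ) :
    HasSum (fun a => poissonWeight l a * walkMean a fun y => (y : ℝ) ^ 2) l := by
  simp only [walkMean_sq]
  exact hasSum_poissonWeight_mul_self l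

lemma hasSum_walkMean_pow_four (l : ℝ) :
    HasSum (fun a => poissonWeight l a * walkMean a fun y => (y : ℝ) ^ 4) (3 * l ^ 2 + l) := by
  simp only [walkMean_pow_four]
  convert! ((hasSum_poissonWeight_mul_sq l).mul_left 3).sub
    ((hasSum_poissonWeight_mul_self l).mul_left 2) using 1
  · ext a; ring
  · ring

/-! ### Independence and law of the observed increments -/

section Increments

variable {Ω : Type*} [MeasurableSpace Ω] {P : Measure Ω}

/-- Splitting on the value of one jump, independent of the others, reproduces the recursion of
`walkProb`. Arbitrary index sets are allowed because the jumps in a later time interval form a block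
not starting at `0`. -/
lemma IsSymmetricBernoulliSequence.measure_sum_eq {ε : ℕ → Ω → ℤ}
    [IsProbabilityMeasure P] (h : IsSymmetricBernoulliSequence ε P) (S : Finset ℕ) (y : ℤ) :
    P {ω | ∑ j ∈ S, ε j ω = y} = ENNReal.ofReal (walkProb S.card y) := by
  induction S using Finset.induction_on generalizing y with
  | empty =>
    by_cases hy : y = 0
    · simp [walkProb, hy]
    · simp [walkProb, hy, Ne.symm hy]
  | insert i S hi ih =>
    have hind : IndepFun (∑ j ∈ S, ε j) (ε i) P :=
      h.indep.indepFun_finsetSum_of_notMem h.measurable hi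
    have hmS : Measurable (∑ j ∈ S, ε j) := by
      convert! Finset.measurable_sum S fun j _ => h.measurable j using 1
      ext ω; simp
    have hprob : ∀ e z : ℤ, P {ω | ε i ω = e ∧ ∑ j ∈ S, ε j ω = z}
        = P {ω | ε i ω = e} * ENNReal.ofReal (walkProb S.card z) := by
      intro e z
      have := hind.measure_inter_preimage_eq_mul {z} {e} (measurableSet_singleton _)
        (measurableSet_singleton _)
      rw [← ih z, mul_comm]
      convert! this using 2
      · ext ω; simp [and_comm]
      · congr 1; ext ω; simp
    have hm : ∀ e, MeasurableSet {ω | ε i ω = e} := fun e =>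
      h.measurable i (measurableSet_singleton e)
    have hae : ∀ᵐ ω ∂P, ε i ω = 1 ∨ ε i ω = -1 := by
      have hd : Disjoint {ω | ε i ω = 1} {ω | ε i ω = -1} := by
        rw [Set.disjoint_left]; intro ω h1 h2
        simp only [Set.mem_ofPred_eq] at h1 h2
        omega
      have h1 : P ({ω | ε i ω = 1} ∪ {ω | ε i ω = -1}) = 1 := by
        rw [measure_union hd (hm _), h.prob_one, h.prob_neg_one, ENNReal.add_halves]
      have := (prob_compl_eq_zero_iff ((hm 1).union (hm (-1)))).2 h1
      rw [ae_iff]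
      convert! this using 2
    have heq : P {ω | ∑ j ∈ insert i S, ε j ω = y}
        = P ({ω | ε i ω = 1 ∧ ∑ j ∈ S, ε j ω = y - 1} ∪
          {ω | ε i ω = -1 ∧ ∑ j ∈ S, ε j ω = y + 1}) := by
      refine measure_congr ?_
      filter_upwards [hae] with ω hω
      simp only [eq_iff_iff]
      change (_ = y) ↔ _
      rw [Finset.sum_insert hi]
      change _ ↔ ((_ = (1 : ℤ) ∧ _ = y - 1) ∨ (_ = (-1 : ℤ) ∧ _ = y + 1))
      omega
    rw [heq, measure_union, hprob, hprob, h.prob_one, h.prob_neg_one, Finset.card_insert_of_notMem hi,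
      walkProb, ← mul_add, ← ENNReal.ofReal_add (walkProb_nonneg _ _) (walkProb_nonneg _ _),
      div_eq_inv_mul, ENNReal.ofReal_mul (by norm_num)]
    · congr 1
      rw [ENNReal.ofReal_inv_of_pos (by norm_num)]
      simp
    · rw [Set.disjoint_left]; rintro ω ⟨h1, _⟩ ⟨h2, _⟩
      omega
    · refine (hm _).inter (?_ : MeasurableSet {ω | ∑ j ∈ S, ε j ω = y + 1})
      have := hmS (measurableSet_singleton (y + 1))
      convert! this using 1
      ext ω; simp

lemma IsSymmetricBernoulliSequence.measure_block_sums_eq {ε : ℕ → Ω → ℤ}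
    [IsProbabilityMeasure P] (h : IsSymmetricBernoulliSequence ε P) (m : ℕ → ℕ) (y : ℕ → ℤ)
    (n : ℕ) :
    P {ω | ∀ i < n, ∑ j ∈ Finset.Ico (∑ k ∈ Finset.range i, m k) (∑ k ∈ Finset.range (i + 1), m k),
      ε j ω = y i} = ∏ i ∈ Finset.range n, ENNReal.ofReal (walkProb (m i) (y i)) := by
  induction n with
  | zero => simp
  | succ n ih =>
    set c : ℕ → ℕ := fun i => ∑ k ∈ Finset.range i, m k with hc
    have hcm : Monotone c := fun i j hij =>
      Finset.sum_le_sum_of_subset (Finset.range_subset_range.2 hij)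
    have hind := h.indep.indepFun_finset (Finset.range (c n)) (Finset.Ico (c n) (c (n + 1)))
      (by rw [Finset.disjoint_left]; intro j; simp; omega) h.measurable
    have hlast := h.measure_sum_eq (Finset.Ico (c n) (c (n + 1))) (y n)
    have hcard : (Finset.Ico (c n) (c (n + 1))).card = m n := by
      simp [hc, Finset.sum_range_succ]
    rw [hcard] at hlast
    rw [Finset.prod_range_succ, ← ih, ← hlast]
    -- The event must be expressed through the first `c n` jumps alone to use independence of
    -- disjoint index sets. The default `0` is never reached, as all blocks before the `n`-th lie
    -- below `c n`.
    set A : Set (Finset.range (c n) → ℤ) :=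
      {e | ∀ i < n, ∑ j ∈ (Finset.Ico (c i) (c (i + 1))).attach,
        (if hj : (j : ℕ) ∈ Finset.range (c n) then e ⟨j, hj⟩ else 0) = y i} with hA
    set B : Set (Finset.Ico (c n) (c (n + 1)) → ℤ) := {e | ∑ j, e j = y n} with hB
    have := hind.measure_inter_preimage_eq_mul A B (Set.to_countable A).measurableSet
      (Set.to_countable B).measurableSet
    have hAe : (fun ω (i : Finset.range (c n)) => ε i ω) ⁻¹' A
        = {ω | ∀ i < n, ∑ j ∈ Finset.Ico (c i) (c (i + 1)), ε j ω = y i} := by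
      ext ω
      simp only [hA, Set.mem_preimage, Set.mem_ofPred_eq]
      refine forall₂_congr fun i hi => ?_
      rw [← Finset.sum_attach (Finset.Ico (c i) (c (i + 1)))]
      refine Eq.congr_left (Finset.sum_congr rfl fun j _ => ?_)
      have hj := Finset.mem_Ico.1 j.2
      have : (j : ℕ) ∈ Finset.range (c n) :=
        Finset.mem_range.2 (hj.2.trans_le (hcm (by omega)))
      rw [dif_pos this]
    have hBe : (fun ω (i : Finset.Ico (c n) (c (n + 1))) => ε i ω) ⁻¹' B
        = {ω | ∑ j ∈ Finset.Ico (c n) (c (n + 1)), ε j ω = y n} := by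
      ext ω
      simp only [hB, Set.mem_preimage, Set.mem_ofPred_eq]
      rw [← Finset.sum_attach (Finset.Ico (c n) (c (n + 1)))]
      rfl
    rw [hAe, hBe] at this
    rw [← this]
    congr 1
    ext ω
    simp only [Set.mem_ofPred_eq, Set.mem_inter_iff]
    constructor
    · intro H; exact ⟨fun i hi => H i (by omega), H n (by omega)⟩
    · rintro ⟨H1, H2⟩ i hi
      rcases Nat.lt_succ_iff_lt_or_eq.1 hi with hi | rfl
      · exact H1 i hi
      · exact H2

lemma measurable_sum_Ico_eval :
    Measurable fun q : (ℕ × ℕ) × (ℕ → ℤ) => ∑ j ∈ Finset.Ico q.1.1 q.1.2, q.2 j := by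
  refine measurable_from_prod_countable_right fun p => ?_
  change Measurable fun e : ℕ → ℤ => ∑ j ∈ Finset.Ico p.1 p.2, e j
  fun_prop

/-- The increments of a compound Poisson process over successive intervals of length `Δ` are
independent with law `incrLaw (ϑ Δ)`. -/
lemma IsBernoulliCompoundPoisson.measure_increments_eq [IsProbabilityMeasure P] {ϑ : ℝ}
    (hϑ : 0 < ϑ) {X : ℝ≥0 → Ω → ℤ} (hX : IsBernoulliCompoundPoisson ϑ X P) (Δ : ℝ≥0)
    (y : ℕ → ℤ) (n : ℕ) :
    P {ω | ∀ i < n, X ((i + 1 : ℕ) * Δ) ω - X ((i : ℕ) * Δ) ω = y i}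
      = ∏ i ∈ Finset.range n, ENNReal.ofReal (incrProb (ϑ * Δ) (y i)) := by
  obtain ⟨N, ε, hN, hε, hNε, hXs⟩ := hX
  set t : ℕ → ℝ≥0 := fun i => i * Δ with ht
  have htm : Monotone t := fun i j hij => by
    simp only [ht]; gcongr
  set A : Ω → ℕ → ℕ := fun ω i => N (t (i + 1)) ω - N (t i) ω with hA
  have hAm : Measurable A := measurable_pi_lambda _ fun i =>
    (hN.measurable _).sub (hN.measurable _)
  have hεm : Measurable fun ω i => ε i ω := measurable_pi_lambda _ hε.measurable
  have hind : IndepFun A (fun ω i => ε i ω) P := by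
    refine hNε.comp (φ := fun (f : ℝ≥0 → ℕ) i => f (t (i + 1)) - f (t i)) (ψ := id) ?_ measurable_id
    fun_prop
  have hAind : iIndepFun (fun i ω => A ω i) P := hN.indep_increments.nat htm
  -- Monotone paths make the truncated subtraction in `A` exact, so `N` at the grid points is the
  -- cumulative sum of the counts and each increment of `X` is a block sum of jumps.
  have hNs : ∀ᵐ ω ∂P, ∀ i, N (t i) ω = ∑ k ∈ Finset.range i, A ω k := by
    filter_upwards [hN.start_zero, hN.monotone_path] with ω h0 hm i
    induction i with
    | zero => simp [ht, h0]
    | succ i ih =>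
      rw [Finset.sum_range_succ, ← ih]
      have := hm (htm (Nat.le_succ i))
      simp only [hA]
      exact (Nat.add_sub_cancel' this).symm
  set S : Set ((ℕ → ℕ) × (ℕ → ℤ)) := {q | ∀ i < n,
    ∑ j ∈ Finset.Ico (∑ k ∈ Finset.range i, q.1 k) (∑ k ∈ Finset.range (i + 1), q.1 k),
      q.2 j = y i} with hS
  have hSm : MeasurableSet S := by
    have : S = ⋂ i ∈ Finset.range n, {q | ∑ j ∈ Finset.Ico (∑ k ∈ Finset.range i, q.1 k)
        (∑ k ∈ Finset.range (i + 1), q.1 k), q.2 j = y i} := by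
      ext q; simp [hS]
    rw [this]
    refine Finset.measurableSet_biInter _ fun i _ => ?_
    have hm : Measurable fun q : (ℕ → ℕ) × (ℕ → ℤ) =>
        (((∑ k ∈ Finset.range i, q.1 k, ∑ k ∈ Finset.range (i + 1), q.1 k), q.2) :
          (ℕ × ℕ) × (ℕ → ℤ)) := by fun_prop
    exact (measurable_sum_Ico_eval.comp hm) (measurableSet_singleton (y i))
  have h1 : P {ω | ∀ i < n, X ((i + 1 : ℕ) * Δ) ω - X ((i : ℕ) * Δ) ω = y i}
      = P ((fun ω => (A ω, fun i => ε i ω)) ⁻¹' S) := by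
    refine measure_congr ?_
    filter_upwards [hNs, hN.monotone_path] with ω h hm
    change (∀ i < n, _) = (∀ i < n, _)
    simp only [eq_iff_iff]
    refine forall₂_congr fun i _ => ?_
    rw [← h i, ← h (i + 1), hXs, hXs, Finset.sum_Ico_eq_sub _ (hm (htm (Nat.le_succ i)))]
  have hl : 0 ≤ ϑ * (Δ : ℝ) := by positivity
  have h2 : ∀ i, ∫⁻ ω, ENNReal.ofReal (walkProb (A ω i) (y i)) ∂P
      = ENNReal.ofReal (incrProb (ϑ * Δ) (y i)) := by
    intro i
    have hlaw := hN.increment_law (t i) (t (i + 1)) (htm (Nat.le_succ i))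
    have hd : t (i + 1) - t i = Δ := by
      simp only [ht]; push_cast; rw [add_mul, one_mul, add_tsub_cancel_left]
    rw [hd] at hlaw
    have := lintegral_map (μ := P) (f := fun a : ℕ => ENNReal.ofReal (walkProb a (y i)))
      (g := fun ω => A ω i) Measurable.of_discrete (by fun_prop)
    rw [← this]
    simp only [hA]
    rw [hlaw, ofReal_incrProb hl, poissonMeasure, lintegral_sum_measure]
    congr 1; ext a
    rw [lintegral_smul_measure, lintegral_dirac, smul_eq_mul]
    congr 2
    simp [poissonWeight, Real.coe_toNNReal _ hϑ.le]
  -- Fubini for the product law of counts and jumps: given the counts `m`, the blocks are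
  -- deterministic and the conditional probability is a product (`h3`). Independence of the counts
  -- then factorises the outer integral.
  rw [h1, ← Measure.map_apply (hAm.prodMk hεm) hSm,
    (indepFun_iff_map_prod_eq_prod_map_map hAm.aemeasurable hεm.aemeasurable).1 hind,
    Measure.prod_apply hSm]
  have h3 : ∀ m : ℕ → ℕ, (P.map fun ω i => ε i ω) (Prod.mk m ⁻¹' S)
      = ∏ i ∈ Finset.range n, ENNReal.ofReal (walkProb (m i) (y i)) := by
    intro m
    rw [Measure.map_apply hεm (measurable_prodMk_left hSm), ← hε.measure_block_sums_eq m y n]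
    rfl
  simp only [h3]
  have hwm : ∀ z, Measurable fun a : ℕ => ENNReal.ofReal (walkProb a z) :=
    fun z => Measurable.of_discrete
  rw [lintegral_map (f := fun m : ℕ → ℕ =>
      ∏ i ∈ Finset.range n, ENNReal.ofReal (walkProb (m i) (y i)))
      (Finset.measurable_prod _ fun i _ => (hwm (y i)).comp (measurable_pi_apply i)) hAm,
    lintegral_prod_eq_prod_lintegral_of_indepFun (Finset.range n)
    (fun i ω => ENNReal.ofReal (walkProb (A ω i) (y i)))
    (hAind.comp (fun i a => ENNReal.ofReal (walkProb a (y i))) fun i => hwm (y i))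
    (fun i => (hwm (y i)).comp ((measurable_pi_apply i).comp hAm))]
  exact Finset.prod_congr rfl fun i _ => h2 i

/-- The increments of a path observed at successive times, when the path starts at `0`. -/
def increments {n : ℕ} (x : Fin n → ℤ) (i : Fin n) : ℤ :=
  x i - (Fin.cons 0 x : Fin (n + 1) → ℤ) i.castSucc

/-- A path is recovered by summing its increments from `0`. Point masses of the observation law can
therefore be read off from the law of the increments. -/
lemma increments_injective {n : ℕ} : Function.Injective (increments (n := n)) := by
  intro x x' h
  have key : ∀ i : Fin (n + 1), (Fin.cons 0 x : Fin (n + 1) → ℤ) i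
      = (Fin.cons 0 x' : Fin (n + 1) → ℤ) i := by
    intro i
    induction i using Fin.induction with
    | zero => simp
    | succ i ih =>
      have := congrFun h i
      simp only [increments] at this
      rw [Fin.cons_succ, Fin.cons_succ]
      linarith
  ext i
  simpa using key i.succ

lemma observationLaw_map_increments [IsProbabilityMeasure P] {ϑ : ℝ} (hϑ : 0 < ϑ)
    {X : ℝ≥0 → Ω → ℤ} (hX : IsBernoulliCompoundPoisson ϑ X P) (T : ℝ) {Δ : ℝ} (hΔ : 0 < Δ) :
    (observationLaw P X T Δ).map increments
      = Measure.pi fun _ : Fin ⌊T / Δ⌋₊ => incrLaw (ϑ * Δ) := by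
  have hXm : ∀ t, Measurable (X t) := by
    obtain ⟨N, ε, hN, hε, -, hXs⟩ := hX
    intro t
    have hεm : Measurable fun ω i => ε i ω := measurable_pi_lambda _ hε.measurable
    have := measurable_sum_Ico_eval.comp
      (((measurable_const (a := 0)).prodMk (hN.measurable t)).prodMk hεm)
    convert! this using 1
    ext ω
    simp [hXs]
  have hX0 : ∀ᵐ ω ∂P, X 0 ω = 0 := by
    obtain ⟨N, ε, hN, hε, -, hXs⟩ := hX
    filter_upwards [hN.start_zero] with ω h
    simp [hXs, h]
  have hprob := isProbabilityMeasure_incrLaw (l := ϑ * Δ) (by positivity)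
  set n := ⌊T / Δ⌋₊
  refine Measure.ext_of_singleton fun y => ?_
  rw [Measure.pi_singleton]
  simp only [incrLaw_singleton]
  -- Only indices below `n` enter the event, so the value `0` beyond `n` is immaterial.
  have h := hX.measure_increments_eq hϑ Δ.toNNReal (fun i => if hi : i < n then y ⟨i, hi⟩ else 0) n
  rw [Finset.prod_range, Real.coe_toNNReal _ hΔ.le] at h
  simp only [Fin.is_lt, dif_pos, Fin.eta] at h
  rw [← h, observationLaw, Measure.map_map Measurable.of_discrete
    (measurable_pi_lambda _ fun i => hXm _), Measure.map_apply
    (Measurable.of_discrete.comp (measurable_pi_lambda _ fun i => hXm _))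
    (measurableSet_singleton y)]
  refine measure_congr ?_
  filter_upwards [hX0] with ω h0
  have htime : ∀ k : ℕ, ((k : ℝ) * Δ).toNNReal = k * Δ.toNNReal := fun k => by
    rw [Real.toNNReal_mul (by positivity), Real.toNNReal_natCast]
  have hcons : ∀ i : Fin (n + 1),
      (Fin.cons 0 (fun i : Fin n => X (((i : ℝ) + 1) * Δ).toNNReal ω) : Fin (n + 1) → ℤ) i
        = X ((i : ℕ) * Δ.toNNReal) ω := by
    intro i
    refine Fin.cases ?_ (fun i => ?_) i
    · simp [h0]
    · rw [Fin.cons_succ, ← htime]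
      simp
  change ((increments fun i : Fin n => X (((i : ℝ) + 1) * Δ).toNNReal ω) = y) = (∀ i < n, _)
  rw [funext_iff, eq_iff_iff]
  have hinc : ∀ i : Fin n, increments (fun i : Fin n => X (((i : ℝ) + 1) * Δ).toNNReal ω) i
      = X ((i + 1 : ℕ) * Δ.toNNReal) ω - X ((i : ℕ) * Δ.toNNReal) ω := by
    intro i
    rw [increments, hcons, Fin.val_castSucc, ← htime, ← htime]
    push_cast; rfl
  simp only [hinc]
  constructor
  · intro H i hi
    rw [dif_pos hi]
    exact H ⟨i, hi⟩
  · intro H i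
    have := H i i.2
    rwa [dif_pos i.2] at this

lemma observationLaw_singleton [IsProbabilityMeasure P] {ϑ : ℝ} (hϑ : 0 < ϑ)
    {X : ℝ≥0 → Ω → ℤ} (hX : IsBernoulliCompoundPoisson ϑ X P) (T : ℝ) {Δ : ℝ} (hΔ : 0 < Δ)
    (x : Fin ⌊T / Δ⌋₊ → ℤ) :
    observationLaw P X T Δ {x} = ENNReal.ofReal (∏ i, incrProb (ϑ * Δ) (increments x i)) := by
  have hprob := isProbabilityMeasure_incrLaw (l := ϑ * Δ) (by positivity)
  have h := congrArg (fun μ => μ {increments x}) (observationLaw_map_increments hϑ hX T hΔ)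
  rw [Measure.map_apply Measurable.of_discrete (measurableSet_singleton _),
    Measure.pi_singleton] at h
  have hpre : increments ⁻¹' {increments x} = {x} := by
    ext z; simp [increments_injective.eq_iff]
  rw [hpre] at h
  rw [h, ENNReal.ofReal_prod_of_nonneg fun i _ => incrProb_nonneg (by positivity) _]
  exact Finset.prod_congr rfl fun i _ => incrLaw_singleton _ _

end Increments

/-! ### Local limit theorem by Fourier inversion -/

section LocalLimit

open Real

lemma integral_cos_mul_int (y : ℤ) :
    ∫ u in (-π)..π, cos (u * y) = if y = 0 then 2 * π else 0 := by
  split_ifs with hy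
  · simp [hy]; ring
  · have hy' : (y : ℝ) ≠ 0 := by exact_mod_cast hy
    rw [intervalIntegral.integral_comp_mul_right (fun u => cos u) hy', integral_cos]
    have h1 : sin (π * y) = 0 := by rw [mul_comm]; exact sin_int_mul_pi y
    rw [neg_mul, sin_neg, h1]
    simp

/-- One step has characteristic function `cos u`. The recursion holds because the average of `cos (u
(y - 1))` and `cos (u (y + 1))` is `cos u * cos (u y)`. -/
lemma walkProb_eq_integral (a : ℕ) (y : ℤ) :
    walkProb a y = (2 * π)⁻¹ * ∫ u in (-π)..π, cos u ^ a * cos (u * y) := by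
  induction a generalizing y with
  | zero =>
    simp only [pow_zero, one_mul, integral_cos_mul_int, walkProb]
    split_ifs
    · field_simp
    · simp
  | succ a ih =>
    rw [walkProb, ih, ih, ← mul_add, mul_div_assoc, ← intervalIntegral.integral_add
      (Continuous.intervalIntegrable (by fun_prop) _ _)
      (Continuous.intervalIntegrable (by fun_prop) _ _), ← intervalIntegral.integral_div]
    congr 1
    refine intervalIntegral.integral_congr fun u _ => ?_
    push_cast
    rw [mul_sub, mul_add, mul_one, cos_sub, cos_add]
    ring

lemma incrProb_eq_integral {l : ℝ} (hl : 0 ≤ l) (y : ℤ) :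
    incrProb l y = (2 * π)⁻¹ * ∫ u in (-π)..π, exp (-(l * (1 - cos u))) * cos (u * y) := by
  have h := intervalIntegral.hasSum_integral_of_dominated_convergence (μ := volume)
    (a := -π) (b := π)
    (F := fun a u => poissonWeight l a * cos u ^ a * cos (u * y))
    (f := fun u => exp (-(l * (1 - cos u))) * cos (u * y))
    (fun a _ => poissonWeight l a)
    (fun a => Continuous.aestronglyMeasurable (by fun_prop)) ?_ ?_ ?_ ?_
  · rw [← h.tsum_eq, ← tsum_mul_left, incrProb]
    congr 1; ext a
    rw [walkProb_eq_integral, mul_left_comm, ← intervalIntegral.integral_const_mul]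
    simp only [mul_assoc]
  · intro a
    refine Eventually.of_forall fun u _ => ?_
    have h0 := poissonWeight_nonneg hl a
    rw [norm_eq_abs, abs_mul, abs_mul, abs_pow, abs_of_nonneg h0, mul_assoc]
    refine mul_le_of_le_one_right h0 (mul_le_one₀ ?_ (abs_nonneg _) (abs_cos_le_one _))
    exact pow_le_one₀ (abs_nonneg _) (abs_cos_le_one _)
  · exact Eventually.of_forall fun u _ => (hasSum_poissonWeight l).summable
  · exact Continuous.intervalIntegrable (by fun_prop) _ _
  · refine Eventually.of_forall fun u _ => ?_
    have := (hasSum_poissonWeight_mul_pow l (cos u)).mul_right (cos (u * y))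
    convert! this using 3
    ring

/-- The density of the centered Gaussian distribution with variance `l`. -/
noncomputable def gaussDensity (l y : ℝ) : ℝ := exp (-(y ^ 2 / (2 * l))) / √(2 * π * l)

lemma gaussDensity_pos {l : ℝ} (hl : 0 < l) (y : ℝ) : 0 < gaussDensity l y := by
  unfold gaussDensity; positivity

lemma gaussDensity_eq_integral {l : ℝ} (hl : 0 < l) (y : ℝ) :
    gaussDensity l y = (2 * π)⁻¹ * ∫ u : ℝ, exp (-(l * u ^ 2 / 2)) * cos (u * y) := by
  have hb : 0 < ((l / 2 : ℝ) : ℂ).re := by rw [Complex.ofReal_re]; positivity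
  have h := fourierIntegral_gaussian hb (y : ℂ)
  have hint : Integrable fun x : ℝ =>
      Complex.exp (Complex.I * y * x) * Complex.exp (-((l / 2 : ℝ) : ℂ) * x ^ 2) := by
    have := integrable_cexp_quadratic hb (Complex.I * y) 0
    refine this.congr (Eventually.of_forall fun x => ?_)
    simp only
    rw [← Complex.exp_add]
    congr 1; ring
  have h2 := congrArg Complex.re h
  rw [← RCLike.re_eq_complex_re, ← integral_re hint] at h2
  have e1 : ∀ x : ℝ, RCLike.re
      (Complex.exp (Complex.I * y * x) * Complex.exp (-((l / 2 : ℝ) : ℂ) * x ^ 2))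
      = exp (-(l * x ^ 2 / 2)) * cos (x * y) := by
    intro x
    rw [← Complex.exp_add, RCLike.re_eq_complex_re, Complex.exp_re]
    congr 2
    · simp [← Complex.ofReal_pow]; ring
    · simp [← Complex.ofReal_pow]; ring
  simp only [e1] at h2
  rw [h2, RCLike.re_eq_complex_re]
  have e2 : ((π : ℂ) / ((l / 2 : ℝ) : ℂ)) ^ (1 / 2 : ℂ)
      * Complex.exp (-(y : ℂ) ^ 2 / (4 * ((l / 2 : ℝ) : ℂ)))
      = ((√(π / (l / 2)) * exp (-(y ^ 2 / (2 * l))) : ℝ) : ℂ) := by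
    rw [sqrt_eq_rpow]
    push_cast
    rw [Complex.ofReal_cpow (by positivity)]
    push_cast
    congr 2
    field_simp
    norm_num
  rw [e2, Complex.ofReal_re, gaussDensity]
  have hs : √(π / (l / 2)) * √(2 * π * l) = 2 * π := by
    rw [← sqrt_mul (by positivity)]
    have : π / (l / 2) * (2 * π * l) = (2 * π) ^ 2 := by field_simp
    rw [this, sqrt_sq (by positivity)]
  have h3 : 0 < √(2 * π * l) := by positivity
  rw [div_eq_iff h3.ne']
  calc exp (-(y ^ 2 / (2 * l))) = (2 * π)⁻¹ * (2 * π) * exp (-(y ^ 2 / (2 * l))) := by field_simp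
    _ = (2 * π)⁻¹ * (√(π / (l / 2)) * √(2 * π * l)) * exp (-(y ^ 2 / (2 * l))) := by rw [hs]
    _ = _ := by ring

lemma cos_sub_one_sub_le (u : ℝ) : cos u - (1 - u ^ 2 / 2) ≤ u ^ 4 := by
  rcases le_or_gt |u| 1 with h | h
  · have := (le_abs_self _).trans (cos_bound h)
    rw [pow_abs, abs_of_nonneg (by positivity : (0 : ℝ) ≤ u ^ 4)] at this
    nlinarith [sq_nonneg (u ^ 2)]
  · have h1 : 1 ≤ u ^ 2 := by
      rw [← sq_abs]; nlinarith
    have := cos_le_one u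
    nlinarith

/-- Half of the Gaussian decay absorbs the polynomial, by `x² / 2 ≤ exp x` at `x = l u² / 10`. The
factor `1 / l` gained is the relative accuracy of the local limit theorem. -/
lemma exp_quartic_bound {l : ℝ} (hl : 0 < l) (u : ℝ) :
    l * u ^ 4 * exp (-(l * u ^ 2 / 5)) ≤ 200 / l * exp (-(l / 10) * u ^ 2) := by
  have h := quadratic_le_exp_of_nonneg (x := l * u ^ 2 / 10) (by positivity)
  have h2 : (l * u ^ 2) ^ 2 ≤ 200 * exp (l * u ^ 2 / 10) := by
    have : 0 ≤ l * u ^ 2 := by positivity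
    nlinarith
  have e : exp (-(l / 10) * u ^ 2) = exp (l * u ^ 2 / 10) * exp (-(l * u ^ 2 / 5)) := by
    rw [← exp_add]; congr 1; ring
  rw [e]
  calc l * u ^ 4 * exp (-(l * u ^ 2 / 5))
      = (l * u ^ 2) ^ 2 / l * exp (-(l * u ^ 2 / 5)) := by field_simp
    _ ≤ (200 * exp (l * u ^ 2 / 10)) / l * exp (-(l * u ^ 2 / 5)) := by gcongr
    _ = _ := by ring

/-- For `a ≤ b`, `exp (-a) - exp (-b) ≤ (b - a) exp (-a)`. The gap `b - a` is of fourth order in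
`u`, and `1 - cos u ≥ 2 u² / π² ≥ u² / 5` keeps `exp (-a)` of Gaussian size on all of `[-π, π]`. -/
lemma exp_cos_sub_gauss_le {l : ℝ} (hl : 0 < l) {u : ℝ} (hu : |u| ≤ π) :
    |exp (-(l * (1 - cos u))) - exp (-(l * u ^ 2 / 2))| ≤ l * u ^ 4 * exp (-(l * u ^ 2 / 5)) := by
  have h1 := cos_sub_one_sub_le u
  have h2 := one_sub_sq_div_two_le_cos (x := u)
  have h3 := cos_le_one_sub_mul_cos_sq hu
  have hpi : (1 : ℝ) / 5 ≤ 2 / π ^ 2 := by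
    rw [div_le_div_iff₀ (by norm_num) (by positivity)]
    nlinarith [pi_lt_d2, pi_pos]
  have h4 : u ^ 2 / 5 ≤ 1 - cos u := by
    have : 1 / 5 * u ^ 2 ≤ 2 / π ^ 2 * u ^ 2 := by gcongr
    linarith
  set a := l * (1 - cos u) with ha
  set b := l * u ^ 2 / 2 with hb
  have hab : a ≤ b := by rw [ha, hb]; nlinarith
  have hba : b - a ≤ l * u ^ 4 := by rw [ha, hb]; nlinarith
  have hexp : exp (-b) = exp (-a) * exp (-(b - a)) := by rw [← exp_add]; congr 1; ring
  rw [abs_of_nonneg (by simpa using hab)]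
  have h5 := add_one_le_exp (-(b - a))
  calc exp (-a) - exp (-b) = exp (-a) * (1 - exp (-(b - a))) := by rw [hexp]; ring
    _ ≤ exp (-a) * (l * u ^ 4) := by gcongr; linarith
    _ = l * u ^ 4 * exp (-a) := by ring
    _ ≤ l * u ^ 4 * exp (-(l * u ^ 2 / 5)) := by
      gcongr
      rw [ha]; nlinarith

lemma abs_incrProb_sub_gaussDensity_le {l : ℝ} (hl : 1 ≤ l) (y : ℤ) :
    |incrProb l y - gaussDensity l y| ≤ (2 * π)⁻¹ * (200 / l * √(π / (l / 10))) := by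
  have hl0 : 0 < l := by linarith
  rw [incrProb_eq_integral hl0.le, gaussDensity_eq_integral hl0, ← mul_sub, abs_mul,
    abs_of_pos (by positivity : 0 < (2 * π)⁻¹)]
  gcongr
  set F : ℝ → ℝ := (Set.Ioc (-π) π).indicator
    fun u => exp (-(l * (1 - cos u))) * cos (u * y) with hF
  have hFint : Integrable F := by
    rw [hF, integrable_indicator_iff measurableSet_Ioc]
    exact (Continuous.integrableOn_Icc (by fun_prop)).mono_set Set.Ioc_subset_Icc_self
  have hgint : Integrable fun u : ℝ => exp (-(l * u ^ 2 / 2)) * cos (u * y) := by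
    have := integrable_exp_neg_mul_sq (b := l / 2) (by positivity)
    refine this.mono' (Continuous.aestronglyMeasurable (by fun_prop))
      (Eventually.of_forall fun u => ?_)
    rw [norm_mul, norm_of_nonneg (exp_pos _).le]
    refine (mul_le_of_le_one_right (exp_pos _).le (abs_cos_le_one _)).trans_eq ?_
    congr 1; ring
  rw [intervalIntegral.integral_of_le (by linarith [pi_pos]), ← integral_indicator measurableSet_Ioc,
    ← integral_sub hFint hgint, ← norm_eq_abs]
  have hb := integrable_exp_neg_mul_sq (b := l / 10) (by positivity)
  refine (norm_integral_le_of_norm_le (hb.const_mul (200 / l))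
    (Eventually.of_forall fun u => ?_)).trans_eq ?_
  · refine le_trans ?_ (exp_quartic_bound hl0 u)
    simp only [hF, Set.indicator_apply]
    split_ifs with hu
    · rw [← sub_mul, norm_mul]
      exact (mul_le_of_le_one_right (norm_nonneg _) (abs_cos_le_one _)).trans
        (exp_cos_sub_gauss_le hl0 (abs_le.2 ⟨hu.1.le, hu.2⟩))
    -- Outside `(-π, π]` only the Gaussian integrand remains; the same majorant covers it since `l
    -- u⁴ ≥ 1`.
    · have hu2 : 1 ≤ u ^ 2 := by
        have : 1 ≤ |u| := by
          by_contra! h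
          have h3 := pi_gt_three
          exact hu ⟨by linarith [(abs_lt.1 h).1], by linarith [(abs_lt.1 h).2]⟩
        rw [← sq_abs]; nlinarith
      rw [zero_sub, norm_neg, norm_mul, norm_of_nonneg (exp_pos _).le]
      refine (mul_le_of_le_one_right (exp_pos _).le (abs_cos_le_one _)).trans ?_
      have h1 : exp (-(l * u ^ 2 / 2)) ≤ exp (-(l * u ^ 2 / 5)) := by
        rw [exp_le_exp]; nlinarith
      have h4 : 1 ≤ u ^ 4 := by nlinarith
      refine h1.trans (le_mul_of_one_le_left (exp_pos _).le ?_)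
      nlinarith
  · rw [integral_const_mul, integral_gaussian]

/-- The absolute error is of order `l^(-3/2)`; dividing by the density costs `√l` and the
exponential factor. The constant comes from `100 √20 ≤ 500`. -/
lemma abs_incrProb_div_gaussDensity_sub_one_le {l : ℝ} (hl : 1 ≤ l) (y : ℤ) :
    |incrProb l y / gaussDensity l y - 1| ≤ 500 / l * exp ((y : ℝ) ^ 2 / (2 * l)) := by
  have hl0 : 0 < l := by linarith
  have hg := gaussDensity_pos hl0 y
  have e : incrProb l y / gaussDensity l y - 1
      = (incrProb l y - gaussDensity l y) / gaussDensity l y := by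
    field_simp
  rw [e, abs_div, abs_of_pos hg, div_le_iff₀ hg]
  refine (abs_incrProb_sub_gaussDensity_le hl y).trans ?_
  rw [gaussDensity, mul_assoc, mul_div_assoc', ← exp_add, add_neg_cancel, exp_zero]
  have hs : 0 < √(2 * π * l) := by positivity
  have h1 : √(π / (l / 10)) * √(2 * π * l) = √20 * π := by
    rw [← sqrt_mul (by positivity)]
    have : π / (l / 10) * (2 * π * l) = 20 * π ^ 2 := by field_simp; norm_num
    rw [this, sqrt_mul (by norm_num), sqrt_sq pi_pos.le]
  have h20 : √20 ≤ 5 := by rw [sqrt_le_left (by norm_num)]; norm_num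
  rw [mul_one_div, le_div_iff₀ hs]
  calc (2 * π)⁻¹ * (200 / l * √(π / (l / 10))) * √(2 * π * l)
      = (2 * π)⁻¹ * (200 / l) * (√(π / (l / 10)) * √(2 * π * l)) := by ring
    _ = 100 / l * √20 := by rw [h1]; field_simp; norm_num
    _ ≤ 100 / l * 5 := by gcongr
    _ = 500 / l := by ring

lemma abs_log_le_two_mul {x : ℝ} (hx : |x - 1| ≤ 1 / 2) : |log x| ≤ 2 * |x - 1| := by
  have h := abs_le.1 hx
  have hx0 : 0 < x := by linarith
  rw [abs_le]
  constructor
  · have h1 := one_sub_inv_le_log_of_pos hx0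
    have h2 : -(2 * |x - 1|) ≤ 1 - x⁻¹ := by
      have e : 1 - x⁻¹ = (x - 1) * x⁻¹ := by field_simp
      have h3 : x⁻¹ ≤ 2 := by
        rw [inv_le_comm₀ hx0 (by norm_num)]; linarith
      have h4 : |(x - 1) * x⁻¹| ≤ |x - 1| * 2 := by
        rw [abs_mul, abs_of_pos (inv_pos.2 hx0)]; gcongr
      rw [e]
      linarith [neg_abs_le ((x - 1) * x⁻¹)]
    linarith
  · have := log_le_sub_one_of_pos hx0
    have := le_abs_self (x - 1)
    have := abs_nonneg (x - 1)
    linarith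

/-- In the moderate deviation range, the logarithms of the point probability and of the Gaussian
density are close. -/
lemma abs_log_incrProb_sub_log_gaussDensity_le {l n : ℝ} (hl : 1 ≤ l) (hn : 1 ≤ n)
    (hln : 1000 * n ^ 3 ≤ l) {y : ℤ} (hy : (y : ℝ) ^ 2 ≤ 6 * l * log n) :
    |log (incrProb l y) - log (gaussDensity l y)| ≤ 1000 * n ^ 3 / l := by
  have hl0 : 0 < l := by linarith
  have hn0 : 0 < n := by linarith
  have h := abs_incrProb_div_gaussDensity_sub_one_le hl y
  -- The range `y² ≤ 6 l log n` turns the exponential loss into `exp (3 log n)`.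
  have hexp : exp ((y : ℝ) ^ 2 / (2 * l)) ≤ n ^ 3 := by
    have e : n ^ 3 = exp (3 * log n) := by
      rw [mul_comm, exp_mul, exp_log hn0]
      norm_cast
    rw [e, exp_le_exp, div_le_iff₀ (by positivity)]
    linarith
  have h2 : |incrProb l y / gaussDensity l y - 1| ≤ 500 * n ^ 3 / l :=
    h.trans (by rw [mul_div_right_comm]; gcongr)
  rw [← log_div (incrProb_pos hl0 y).ne' (gaussDensity_pos hl0 y).ne']
  refine (abs_log_le_two_mul (h2.trans ?_)).trans ?_
  · rw [div_le_iff₀ hl0]; linarith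
  · calc _ ≤ 2 * (500 * n ^ 3 / l) := by gcongr
      _ = _ := by ring

end LocalLimit

/-! ### Tails and moments of one increment -/

section Moments

lemma exp_sub_one_le_two_mul {x : ℝ} (h0 : 0 ≤ x) (h1 : x ≤ 1 / 2) : Real.exp x - 1 ≤ 2 * x := by
  have h := Real.exp_bound_div_one_sub_of_interval h0 (by linarith)
  have h2 : 1 / (1 - x) ≤ 1 + 2 * x := by
    rw [div_le_iff₀ (by linarith)]
    nlinarith
  linarith

lemma cosh_sub_one_le_sq {s : ℝ} (hs : s ^ 2 ≤ 1) : Real.cosh s - 1 ≤ s ^ 2 := by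
  have h1 := Real.cosh_le_exp_half_sq s
  have h2 := exp_sub_one_le_two_mul (x := s ^ 2 / 2) (by positivity) (by linarith)
  linarith

lemma integrable_cosh_incrLaw {l : ℝ} (hl : 0 ≤ l) (s : ℝ) :
    Integrable (fun y : ℤ => Real.cosh (s * y)) (incrLaw l) :=
  integrable_incrLaw hl (fun _ => (Real.cosh_pos _).le) (hasSum_walkMean_cosh l s)

lemma integral_cosh_incrLaw_le {l s : ℝ} (hl : 0 ≤ l) (hs : s ^ 2 ≤ 1) :
    ∫ y : ℤ, Real.cosh (s * y) ∂(incrLaw l) ≤ Real.exp (l * s ^ 2) := by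
  rw [integral_incrLaw hl (fun _ => (Real.cosh_pos _).le) (hasSum_walkMean_cosh l s)]
  gcongr
  exact cosh_sub_one_le_sq hs

/-- Chernoff bound with `cosh (s y)`, where `s = K / (2√l)` minimises `l s² - s K √l`. The condition
`K² ≤ 4 l` says `s² ≤ 1`, the range where `cosh s - 1 ≤ s²` is available. -/
lemma incrLaw_real_tail_le {l K : ℝ} (hl : 0 < l) (hK : 0 ≤ K) (hKl : K ^ 2 ≤ 4 * l) :
    (incrLaw l).real {y : ℤ | K ^ 2 * l < (y : ℝ) ^ 2} ≤ 2 * Real.exp (-(K ^ 2 / 4)) := by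
  have := isProbabilityMeasure_incrLaw hl.le
  set s := K / (2 * √l) with hs
  have hsl : √l ^ 2 = l := Real.sq_sqrt hl.le
  have hsp : 0 < √l := Real.sqrt_pos.2 hl
  have hs2 : s ^ 2 = K ^ 2 / (4 * l) := by rw [hs, div_pow, mul_pow, hsl]; norm_num
  have hs0 : 0 ≤ s := by positivity
  have h1 := integral_cosh_incrLaw_le (s := s) hl.le (by rw [hs2, div_le_one (by positivity)]; exact hKl)
  have hm := mul_meas_ge_le_integral_of_nonneg
    (Eventually.of_forall fun y : ℤ => (Real.cosh_pos (s * y)).le)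
    (integrable_cosh_incrLaw hl.le s) (Real.exp (K ^ 2 / 2) / 2)
  have hsub : (incrLaw l).real {y : ℤ | K ^ 2 * l < (y : ℝ) ^ 2}
      ≤ (incrLaw l).real {y : ℤ | Real.exp (K ^ 2 / 2) / 2 ≤ Real.cosh (s * y)} := by
    refine measureReal_mono fun y hy => ?_
    have hy' : K ^ 2 * l < (y : ℝ) ^ 2 := hy
    change Real.exp (K ^ 2 / 2) / 2 ≤ Real.cosh (s * y)
    have h2 : K * √l ≤ |(y : ℝ)| := by
      refine le_of_lt (lt_of_pow_lt_pow_left₀ 2 (abs_nonneg _) ?_)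
      rw [sq_abs, mul_pow, hsl]; exact hy'
    have h3 : K ^ 2 / 2 ≤ |s * y| := by
      rw [abs_mul, abs_of_nonneg hs0]
      calc K ^ 2 / 2 = s * (K * √l) := by rw [hs]; field_simp
        _ ≤ s * |(y : ℝ)| := by gcongr
    rw [← Real.cosh_abs, Real.cosh_eq]
    have := Real.exp_le_exp.2 h3
    have := Real.exp_pos (-|s * y|)
    linarith
  have hl2 : l * s ^ 2 = K ^ 2 / 4 := by rw [hs2]; field_simp
  rw [hl2] at h1
  have he : Real.exp (K ^ 2 / 4) = Real.exp (K ^ 2 / 2) / 2 * (2 * Real.exp (-(K ^ 2 / 4))) := by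
    have : Real.exp (K ^ 2 / 4) = Real.exp (K ^ 2 / 2) * Real.exp (-(K ^ 2 / 4)) := by
      rw [← Real.exp_add]; congr 1; ring
    rw [this]; ring
  have hfin := (mul_le_mul_of_nonneg_left hsub (by positivity :
    0 ≤ Real.exp (K ^ 2 / 2) / 2)).trans (hm.trans h1)
  rw [he] at hfin
  exact le_of_mul_le_mul_left hfin (by positivity)

lemma integrable_sq_incrLaw {l : ℝ} (hl : 0 ≤ l) :
    Integrable (fun y : ℤ => (y : ℝ) ^ 2) (incrLaw l) :=
  integrable_incrLaw hl (fun _ => by positivity) (hasSum_walkMean_sq l)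

lemma integrable_pow_four_incrLaw {l : ℝ} (hl : 0 ≤ l) :
    Integrable (fun y : ℤ => (y : ℝ) ^ 4) (incrLaw l) :=
  integrable_incrLaw hl (fun _ => by positivity) (hasSum_walkMean_pow_four l)

lemma integral_sq_incrLaw {l : ℝ} (hl : 0 ≤ l) : ∫ y : ℤ, (y : ℝ) ^ 2 ∂(incrLaw l) = l :=
  integral_incrLaw hl (fun _ => by positivity) (hasSum_walkMean_sq l)

lemma integral_pow_four_incrLaw {l : ℝ} (hl : 0 ≤ l) :
    ∫ y : ℤ, (y : ℝ) ^ 4 ∂(incrLaw l) = 3 * l ^ 2 + l :=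
  integral_incrLaw hl (fun _ => by positivity) (hasSum_walkMean_pow_four l)

/-- The standardised squared increment. -/
noncomputable def stdSq (l : ℝ) (y : ℤ) : ℝ := ((y : ℝ) ^ 2 / l - 1) / √2

lemma stdSq_sq_eq (l : ℝ) (y : ℤ) :
    stdSq l y ^ 2 = (y : ℝ) ^ 4 * (1 / (2 * l ^ 2)) - (y : ℝ) ^ 2 * (1 / l) + 1 / 2 := by
  rw [stdSq, div_pow, Real.sq_sqrt (by norm_num)]
  ring

lemma integrable_stdSq {l : ℝ} (hl : 0 ≤ l) : Integrable (stdSq l) (incrLaw l) := by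
  have := isProbabilityMeasure_incrLaw hl
  exact (((integrable_sq_incrLaw hl).div_const l).sub (integrable_const 1)).div_const _

lemma integral_stdSq {l : ℝ} (hl : 0 < l) : ∫ y, stdSq l y ∂(incrLaw l) = 0 := by
  have := isProbabilityMeasure_incrLaw hl.le
  simp only [stdSq]
  rw [integral_div, integral_sub ((integrable_sq_incrLaw hl.le).div_const l) (integrable_const 1),
    integral_div, integral_sq_incrLaw hl.le, div_self hl.ne']
  simp

lemma integrable_stdSq_sq {l : ℝ} (hl : 0 ≤ l) :
    Integrable (fun y => stdSq l y ^ 2) (incrLaw l) := by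
  have := isProbabilityMeasure_incrLaw hl
  simp only [stdSq_sq_eq]
  exact (((integrable_pow_four_incrLaw hl).mul_const _).sub
    ((integrable_sq_incrLaw hl).mul_const _)).add (integrable_const _)

lemma integral_stdSq_sq {l : ℝ} (hl : 0 < l) :
    ∫ y, stdSq l y ^ 2 ∂(incrLaw l) = 1 + 1 / (2 * l) := by
  have := isProbabilityMeasure_incrLaw hl.le
  simp only [stdSq_sq_eq]
  have h4 := (integrable_pow_four_incrLaw hl.le).mul_const (1 / (2 * l ^ 2))
  have h2 := (integrable_sq_incrLaw hl.le).mul_const (1 / l)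
  have h42 : Integrable (fun y : ℤ => (y : ℝ) ^ 4 * (1 / (2 * l ^ 2)) - (y : ℝ) ^ 2 * (1 / l))
    (incrLaw l) := h4.sub h2
  rw [integral_add h42 (integrable_const _), integral_sub h4 h2, integral_mul_const,
    integral_mul_const, integral_sq_incrLaw hl.le, integral_pow_four_incrLaw hl.le]
  simp
  field_simp
  ring

lemma pow_six_le_cosh (w : ℝ) : w ^ 6 ≤ 1440 * Real.cosh w := by
  have h := Real.pow_div_factorial_le_exp |w| (abs_nonneg w) 6
  have e : |w| ^ 6 = w ^ 6 := by rw [pow_abs]; exact abs_of_nonneg (by positivity)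
  rw [e] at h
  have h2 := Real.exp_pos (-|w|)
  rw [← Real.cosh_abs, Real.cosh_eq]
  norm_num [Nat.factorial] at h
  linarith

/-- The cube is at most `(y / √l)⁶ + 1`, and a sixth power is dominated by `2 · 6! = 1440` times
`cosh`. At scale `1 / √l` the mean of `cosh` is at most `e`, which makes the third moment bounded
uniformly in `l ≥ 1`. -/
lemma abs_stdSq_pow_three_le {l : ℝ} (hl : 0 < l) (y : ℤ) :
    |stdSq l y| ^ 3 ≤ 1440 * Real.cosh ((√l)⁻¹ * y) + 1 := by
  have h := pow_six_le_cosh ((√l)⁻¹ * y)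
  have e : ((√l)⁻¹ * (y : ℝ)) ^ 6 = ((y : ℝ) ^ 2 / l) ^ 3 := by
    rw [← Real.sq_sqrt hl.le, Real.sqrt_sq (Real.sqrt_nonneg _)]; field_simp
  rw [e] at h
  set x := (y : ℝ) ^ 2 / l with hx
  have hx0 : 0 ≤ x := by positivity
  have h1 : |stdSq l y| ≤ |x - 1| := by
    rw [stdSq, abs_div, abs_of_pos (by positivity : 0 < √2)]
    refine div_le_self (abs_nonneg _) ?_
    rw [Real.one_le_sqrt]; norm_num
  have h2 : |x - 1| ^ 3 ≤ x ^ 3 + 1 := by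
    rcases le_total 1 x with h1x | h1x
    · rw [abs_of_nonneg (by linarith)]
      have : (x - 1) ^ 3 ≤ x ^ 3 := by gcongr; linarith
      linarith
    · rw [abs_of_nonpos (by linarith)]
      have : (-(x - 1)) ^ 3 ≤ 1 := pow_le_one₀ (by linarith) (by linarith)
      have := pow_nonneg hx0 3
      linarith
  have h3 : |stdSq l y| ^ 3 ≤ |x - 1| ^ 3 := by gcongr
  linarith

lemma integrable_abs_stdSq_pow_three {l : ℝ} (hl : 0 < l) :
    Integrable (fun y => |stdSq l y| ^ 3) (incrLaw l) := by
  have := isProbabilityMeasure_incrLaw hl.le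
  refine (((integrable_cosh_incrLaw hl.le (√l)⁻¹).const_mul 1440).add (integrable_const 1)).mono'
    Measurable.of_discrete.aestronglyMeasurable (Eventually.of_forall fun y => ?_)
  rw [Real.norm_of_nonneg (by positivity)]
  exact abs_stdSq_pow_three_le hl y

lemma integral_abs_stdSq_pow_three_le {l : ℝ} (hl : 1 ≤ l) :
    ∫ y, |stdSq l y| ^ 3 ∂(incrLaw l) ≤ 5000 := by
  have hl0 : 0 < l := by linarith
  have := isProbabilityMeasure_incrLaw hl0.le
  have hi := integrable_cosh_incrLaw hl0.le (√l)⁻¹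
  refine (integral_mono (integrable_abs_stdSq_pow_three hl0) ((hi.const_mul 1440).add
    (integrable_const 1)) fun y => abs_stdSq_pow_three_le hl0 y).trans ?_
  have hs : ((√l)⁻¹) ^ 2 = l⁻¹ := by rw [inv_pow, Real.sq_sqrt hl0.le]
  have h := integral_cosh_incrLaw_le (s := (√l)⁻¹) hl0.le
    (by rw [hs]; exact inv_le_one_of_one_le₀ hl)
  rw [hs, mul_inv_cancel₀ hl0.ne'] at h
  have he := Real.exp_one_lt_d9
  simp only [Pi.add_apply]
  rw [integral_add (hi.const_mul 1440) (integrable_const 1), integral_const_mul]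
  simp
  linarith

end Moments

/-! ### Several increments: truncation and variance of the score -/

section ProductLaw

/-- The joint law of `n` independent increments. -/
noncomputable def productLaw (n : ℕ) (l : ℝ) : Measure (Fin n → ℤ) :=
  Measure.pi fun _ => incrLaw l

lemma isProbabilityMeasure_productLaw (n : ℕ) {l : ℝ} (hl : 0 ≤ l) :
    IsProbabilityMeasure (productLaw n l) := by
  have := isProbabilityMeasure_incrLaw hl
  unfold productLaw
  infer_instance

/-- The normalised centered sum of the squared increments. -/
noncomputable def score {n : ℕ} (l : ℝ) (y : Fin n → ℤ) : ℝ := (∑ i, stdSq l (y i)) / √n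

/-- The union bound gives `n · 2 n^(-5/4)`. Any constant above `4` in the cutoff would make this
tend to `0`. -/
lemma productLaw_real_exists_large_le {n : ℕ} {l : ℝ} (hl : 0 < l) (hn : 1 ≤ n)
    (hnl : 5 * Real.log n ≤ 4 * l) :
    (productLaw n l).real {y | ∃ i, 5 * Real.log n * l < (y i : ℝ) ^ 2}
      ≤ 2 * (n : ℝ) ^ (-(1 / 4) : ℝ) := by
  have := isProbabilityMeasure_incrLaw hl.le
  have := isProbabilityMeasure_productLaw n hl.le
  have hn0 : (0 : ℝ) < n := by exact_mod_cast hn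
  have hlog : 0 ≤ Real.log n := Real.log_natCast_nonneg n
  have hK : √(5 * Real.log n) ^ 2 = 5 * Real.log n := Real.sq_sqrt (by positivity)
  have htail := incrLaw_real_tail_le hl (Real.sqrt_nonneg (5 * Real.log n)) (by rw [hK]; exact hnl)
  rw [hK] at htail
  have e : {y : Fin n → ℤ | ∃ i, 5 * Real.log n * l < (y i : ℝ) ^ 2}
      = ⋃ i, (Function.eval i) ⁻¹' {z : ℤ | 5 * Real.log n * l < (z : ℝ) ^ 2} := by
    ext y; simp
  rw [e]
  refine (measureReal_iUnion_fintype_le _).trans ?_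
  have h1 : ∀ i : Fin n, (productLaw n l).real
      ((Function.eval i) ⁻¹' {z : ℤ | 5 * Real.log n * l < (z : ℝ) ^ 2})
      = (incrLaw l).real {z : ℤ | 5 * Real.log n * l < (z : ℝ) ^ 2} := by
    intro i
    exact (measurePreserving_eval (fun _ : Fin n => incrLaw l) i).measureReal_preimage
      (Set.to_countable _).measurableSet.nullMeasurableSet
  simp only [h1, Finset.sum_const, Finset.card_univ, Fintype.card_fin, nsmul_eq_mul]
  refine (mul_le_mul_of_nonneg_left htail hn0.le).trans_eq ?_
  have e2 : Real.exp (-(5 * Real.log n / 4)) = (n : ℝ) ^ (-(5 / 4) : ℝ) := by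
    rw [Real.rpow_def_of_pos hn0]; congr 1; ring
  rw [e2, mul_left_comm]
  congr 1
  nth_rewrite 1 [← Real.rpow_one (n : ℝ)]
  rw [← Real.rpow_add hn0]; norm_num

lemma memLp_stdSq {l : ℝ} (hl : 0 ≤ l) : MemLp (stdSq l) 2 (incrLaw l) :=
  (memLp_two_iff_integrable_sq Measurable.of_discrete.aestronglyMeasurable).2
    (integrable_stdSq_sq hl)

lemma variance_stdSq {l : ℝ} (hl : 0 < l) : Var[stdSq l; incrLaw l] = 1 + 1 / (2 * l) := by
  have := isProbabilityMeasure_incrLaw hl.le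
  rw [variance_eq_sub (memLp_stdSq hl.le), integral_stdSq hl]
  simpa using integral_stdSq_sq hl

/-- Chebyshev's inequality, since the score is centered with variance `1 + 1 / (2l) ≤ 2`. The factor
`a` will be the error in the coefficient of the score. -/
lemma productLaw_score_ge_le {n : ℕ} {l c : ℝ} (hl : 1 ≤ l) (hn : 1 ≤ n) (hc : 0 < c) (a : ℝ) :
    productLaw n l {y | c ≤ |a * score l y|} ≤ ENNReal.ofReal (a ^ 2 * 2 / c ^ 2) := by
  have hl0 : 0 < l := by linarith
  have hn0 : (0 : ℝ) < n := by exact_mod_cast hn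
  have := isProbabilityMeasure_incrLaw hl0.le
  have := isProbabilityMeasure_productLaw n hl0.le
  have hmi : ∀ i : Fin n, MemLp (fun y : Fin n → ℤ => stdSq l (y i)) 2 (productLaw n l) := fun i =>
    (memLp_stdSq hl0.le).comp_measurePreserving
      (measurePreserving_eval (fun _ : Fin n => incrLaw l) i)
  have hms : MemLp (∑ i : Fin n, fun y : Fin n → ℤ => stdSq l (y i)) 2 (productLaw n l) :=
    memLp_finsetSum' _ fun i _ => hmi i
  have hvar : Var[∑ i : Fin n, fun y : Fin n → ℤ => stdSq l (y i); productLaw n l]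
      = n * (1 + 1 / (2 * l)) := by
    rw [productLaw, variance_sum_pi fun _ => memLp_stdSq hl0.le]
    simp [variance_stdSq hl0]
    ring
  have hfun : (fun y : Fin n → ℤ => a * score l y)
      = fun y => (a / √n) * (∑ i : Fin n, fun y : Fin n → ℤ => stdSq l (y i)) y := by
    ext y; simp [score]; ring
  have hmem : MemLp (fun y : Fin n → ℤ => a * score l y) 2 (productLaw n l) := by
    rw [hfun]; exact hms.const_mul _
  have hmean : ∫ y : Fin n → ℤ, a * score l y ∂(productLaw n l) = 0 := by
    simp only [score]
    rw [integral_const_mul, integral_div, integral_finsetSum _ fun i _ =>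
      (hmi i).integrable (by norm_num)]
    have : ∀ i : Fin n, ∫ y : Fin n → ℤ, stdSq l (y i) ∂(productLaw n l) = 0 := by
      intro i
      rw [← integral_stdSq hl0]
      exact integral_comp_eval (μ := fun _ : Fin n => incrLaw l) (i := i) (f := stdSq l)
        Measurable.of_discrete.aestronglyMeasurable
    simp [this]
  have h := meas_ge_le_variance_div_sq hmem hc
  rw [hmean] at h
  simp only [sub_zero] at h
  refine h.trans (ENNReal.ofReal_le_ofReal ?_)
  rw [hfun, variance_const_mul, hvar, div_pow, Real.sq_sqrt hn0.le]
  have h2 : 1 / (2 * l) ≤ 1 := by rw [div_le_one (by positivity)]; linarith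
  have h3 : a ^ 2 / n * (n * (1 + 1 / (2 * l))) = a ^ 2 * (1 + 1 / (2 * l)) := by field_simp
  rw [h3]
  gcongr
  linarith

end ProductLaw

/-! ### Central limit theorem for the score -/

section CentralLimit

lemma norm_cexp_mul_I_sub_taylor_le (x : ℝ) :
    ‖Complex.exp (x * Complex.I) - (1 + x * Complex.I - x ^ 2 / 2)‖ ≤ 4 * |x| ^ 3 := by
  have hn : ‖(x : ℂ) * Complex.I‖ = |x| := by simp
  rcases le_or_gt |x| 1 with h | h
  · have h1 := Complex.exp_bound (x := x * Complex.I) (by rw [hn]; exact h) (n := 3) (by norm_num)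
    have e : ∑ m ∈ Finset.range 3, ((x : ℂ) * Complex.I) ^ m / (m.factorial : ℂ)
        = 1 + x * Complex.I - x ^ 2 / 2 := by
      simp [Finset.sum_range_succ, Nat.factorial, mul_pow]; ring
    rw [e, hn] at h1
    refine h1.trans ?_
    rw [mul_comm]
    gcongr
    norm_num [Nat.factorial]
  · have h1 : ‖Complex.exp (x * Complex.I)‖ = 1 := Complex.norm_exp_ofReal_mul_I x
    have h2 : ‖(1 : ℂ) + x * Complex.I - x ^ 2 / 2‖ ≤ 1 + |x| + |x| ^ 2 / 2 := by
      refine (norm_sub_le _ _).trans (add_le_add ((norm_add_le _ _).trans ?_) ?_)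
      · rw [hn, norm_one]
      · simp
    have h3 : |x| ≤ |x| ^ 3 := le_self_pow₀ h.le (by norm_num)
    have h4 : |x| ^ 2 ≤ |x| ^ 3 := pow_le_pow_right₀ h.le (by norm_num)
    have h5 : 1 ≤ |x| ^ 3 := one_le_pow₀ h.le
    refine (norm_sub_le _ _).trans ?_
    rw [h1]
    linarith

lemma norm_pow_sub_pow_le_mul {a b : ℂ} (ha : ‖a‖ ≤ 1) (hb : ‖b‖ ≤ 1) (n : ℕ) :
    ‖a ^ n - b ^ n‖ ≤ n * ‖a - b‖ := by
  induction n with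
  | zero => simp
  | succ n ih =>
    have e : a ^ (n + 1) - b ^ (n + 1) = (a ^ n - b ^ n) * a + b ^ n * (a - b) := by ring
    rw [e]
    refine (norm_add_le _ _).trans ?_
    rw [norm_mul, norm_mul, norm_pow]
    have h1 : ‖a ^ n - b ^ n‖ * ‖a‖ ≤ n * ‖a - b‖ :=
      (mul_le_of_le_one_right (norm_nonneg _) ha).trans ih
    have h2 : ‖b‖ ^ n * ‖a - b‖ ≤ ‖a - b‖ :=
      mul_le_of_le_one_left (norm_nonneg _) (pow_le_one₀ (norm_nonneg _) hb)
    push_cast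
    linarith

/-- Second-order Taylor expansion under the integral: the linear term has mean zero, and the
remainder `4 |x|³` with the third moment bound `5000` gives `20000`. -/
lemma norm_integral_cexp_stdSq_sub_le {l : ℝ} (hl : 1 ≤ l) (τ : ℝ) :
    ‖∫ y, Complex.exp ((τ * stdSq l y : ℝ) * Complex.I) ∂(incrLaw l)
      - ((1 - τ ^ 2 / 2 * (1 + 1 / (2 * l)) : ℝ) : ℂ)‖ ≤ 20000 * |τ| ^ 3 := by
  have hl0 : 0 < l := by linarith
  have := isProbabilityMeasure_incrLaw hl0.le
  have i1 : Integrable (fun y => ((τ * stdSq l y : ℝ) : ℂ) * Complex.I) (incrLaw l) :=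
    (((integrable_stdSq hl0.le).const_mul τ).ofReal).mul_const _
  have i2 : Integrable (fun y => ((τ ^ 2 / 2 * stdSq l y ^ 2 : ℝ) : ℂ)) (incrLaw l) :=
    ((integrable_stdSq_sq hl0.le).const_mul _).ofReal
  have i0 : Integrable (fun y => Complex.exp ((τ * stdSq l y : ℝ) * Complex.I)) (incrLaw l) := by
    refine (integrable_const (1 : ℝ)).mono' Measurable.of_discrete.aestronglyMeasurable
      (Eventually.of_forall fun y => ?_)
    rw [Complex.norm_exp_ofReal_mul_I]
  have i3 : Integrable (fun y => (1 : ℂ) + ((τ * stdSq l y : ℝ) : ℂ) * Complex.I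
      - ((τ ^ 2 / 2 * stdSq l y ^ 2 : ℝ) : ℂ)) (incrLaw l) :=
    ((integrable_const _).add i1).sub i2
  have e : ((1 - τ ^ 2 / 2 * (1 + 1 / (2 * l)) : ℝ) : ℂ)
      = ∫ y, ((1 : ℂ) + ((τ * stdSq l y : ℝ) : ℂ) * Complex.I
      - ((τ ^ 2 / 2 * stdSq l y ^ 2 : ℝ) : ℂ)) ∂(incrLaw l) := by
    have i01 : Integrable (fun y => (1 : ℂ) + ((τ * stdSq l y : ℝ) : ℂ) * Complex.I)
      (incrLaw l) := (integrable_const _).add i1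
    rw [integral_sub i01 i2, integral_add (integrable_const _) i1, integral_mul_const,
      integral_complex_ofReal, integral_complex_ofReal, integral_const_mul, integral_const_mul,
      integral_stdSq hl0, integral_stdSq_sq hl0]
    simp
  rw [e, ← integral_sub i0 i3]
  have i4 := (integrable_abs_stdSq_pow_three hl0).const_mul (4 * |τ| ^ 3)
  refine (norm_integral_le_of_norm_le i4 (Eventually.of_forall fun y => ?_)).trans ?_
  · have h := norm_cexp_mul_I_sub_taylor_le (τ * stdSq l y)
    rw [abs_mul, mul_pow, ← mul_assoc] at h
    convert! h using 3
    push_cast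
    ring
  · rw [integral_const_mul]
    have := integral_abs_stdSq_pow_three_le hl
    calc _ ≤ 4 * |τ| ^ 3 * 5000 := by gcongr
      _ = _ := by ring

lemma charFun_map_score (n : ℕ) {l : ℝ} (hl : 0 ≤ l) (t : ℝ) :
    charFun ((productLaw n l).map (score l)) t
      = (∫ y, Complex.exp ((t / √n * stdSq l y : ℝ) * Complex.I) ∂(incrLaw l)) ^ n := by
  have := isProbabilityMeasure_incrLaw hl
  rw [charFun_apply_real, integral_map Measurable.of_discrete.aemeasurable
    (Continuous.aestronglyMeasurable (by fun_prop))]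
  have h := integral_fintype_prod_eq_pow (ι := Fin n) (μ := incrLaw l)
    fun y => Complex.exp ((t / √n * stdSq l y : ℝ) * Complex.I)
  rw [Fintype.card_fin] at h
  rw [← h, productLaw]
  congr 1; ext y
  rw [← Complex.exp_sum, ← Finset.sum_mul, score, ← Complex.ofReal_sum, ← Finset.mul_sum]
  congr 2
  push_cast
  ring

/-- Both sides are `n`-th powers of numbers in the unit disc, so their distance is at most `n` times
that of the bases at `τ = t / √n`. The three terms come from the third moment, the excess variance
`1 / (2l)` and the expansion of `exp (-τ² / 2)`. -/
lemma norm_charFun_map_score_sub_le {n : ℕ} (hn : 1 ≤ n) {l : ℝ} (hl : 1 ≤ l) {t : ℝ}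
    (ht : t ^ 2 ≤ n) :
    ‖charFun ((productLaw n l).map (score l)) t - Complex.exp (-t ^ 2 / 2)‖
      ≤ 20000 * |t| ^ 3 / √n + t ^ 2 / (4 * l) + t ^ 4 / (4 * n) := by
  have hl0 : 0 < l := by linarith
  have hn0 : (0 : ℝ) < n := by exact_mod_cast hn
  have hs0 : 0 < √(n : ℝ) := Real.sqrt_pos.2 hn0
  have hs : √(n : ℝ) ^ 2 = n := Real.sq_sqrt hn0.le
  have := isProbabilityMeasure_incrLaw hl0.le
  rw [charFun_map_score n hl0.le]
  set τ := t / √n with hτ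
  have hτ2 : τ ^ 2 = t ^ 2 / n := by rw [hτ, div_pow, hs]
  set a := ∫ y, Complex.exp ((τ * stdSq l y : ℝ) * Complex.I) ∂(incrLaw l) with ha
  set b : ℂ := ((Real.exp (-τ ^ 2 / 2) : ℝ) : ℂ) with hb
  have hbn : b ^ n = Complex.exp (-t ^ 2 / 2) := by
    rw [hb, ← Complex.ofReal_pow, ← Real.exp_nat_mul, Complex.ofReal_exp]
    congr 1
    have : (n : ℝ) * (-τ ^ 2 / 2) = -t ^ 2 / 2 := by
      rw [neg_div, hτ2]; field_simp
    rw [this]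
    push_cast; rfl
  have ha1 : ‖a‖ ≤ 1 := by
    have := norm_integral_le_of_norm_le_const (μ := incrLaw l) (C := 1)
      (f := fun y => Complex.exp ((τ * stdSq l y : ℝ) * Complex.I))
      (Eventually.of_forall fun y => (Complex.norm_exp_ofReal_mul_I _).le)
    simpa [ha] using this
  have hb1 : ‖b‖ ≤ 1 := by
    rw [hb, Complex.norm_real, Real.norm_of_nonneg (Real.exp_pos _).le, Real.exp_le_one_iff]
    have := sq_nonneg τ
    linarith
  have h1 := norm_integral_cexp_stdSq_sub_le hl τ
  have h2 : ‖((1 - τ ^ 2 / 2 * (1 + 1 / (2 * l)) : ℝ) : ℂ) - b‖ ≤ τ ^ 2 / (4 * l) + τ ^ 4 / 4 := by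
    rw [hb, ← Complex.ofReal_sub, Complex.norm_real, Real.norm_eq_abs]
    have h3 := Real.abs_exp_sub_one_sub_id_le (x := -τ ^ 2 / 2) (by
      rw [neg_div, abs_neg, abs_of_nonneg (by positivity), hτ2]
      have : t ^ 2 / n ≤ 1 := by rw [div_le_one hn0]; exact ht
      linarith)
    have e : 1 - τ ^ 2 / 2 * (1 + 1 / (2 * l)) - Real.exp (-τ ^ 2 / 2)
        = -(Real.exp (-τ ^ 2 / 2) - 1 - (-τ ^ 2 / 2)) - τ ^ 2 / (4 * l) := by
      field_simp; ring
    rw [e]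
    refine (abs_sub _ _).trans ?_
    rw [abs_neg, abs_of_nonneg (by positivity : 0 ≤ τ ^ 2 / (4 * l))]
    have e2 : (-τ ^ 2 / 2) ^ 2 = τ ^ 4 / 4 := by ring
    linarith
  rw [← hbn]
  refine (norm_pow_sub_pow_le_mul ha1 hb1 n).trans ?_
  have h4 : ‖a - b‖ ≤ 20000 * |τ| ^ 3 + (τ ^ 2 / (4 * l) + τ ^ 4 / 4) :=
    (norm_sub_le_norm_sub_add_norm_sub _ _ _).trans (add_le_add h1 h2)
  refine (mul_le_mul_of_nonneg_left h4 hn0.le).trans_eq ?_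
  have e3 : |τ| ^ 3 = |t| ^ 3 / (√n * n) := by
    rw [hτ, abs_div, abs_of_pos hs0, div_pow, pow_succ (√(n : ℝ)), hs, mul_comm (n : ℝ)]
  have e4 : τ ^ 4 = t ^ 4 / n ^ 2 := by
    calc τ ^ 4 = (τ ^ 2) ^ 2 := by ring
      _ = _ := by rw [hτ2, div_pow]; ring
  rw [e3, e4, hτ2]
  field_simp
  ring

variable {ι : Type*} {F : Filter ι} {n : ι → ℕ} {l : ι → ℝ}

lemma tendsto_charFun_map_score (hn : Tendsto n F atTop) (hl : Tendsto l F atTop) (t : ℝ) :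
    Tendsto (fun i => charFun ((productLaw (n i) (l i)).map (score (l i))) t) F
      (𝓝 (Complex.exp (-t ^ 2 / 2))) := by
  have hn' : Tendsto (fun i => (n i : ℝ)) F atTop := tendsto_natCast_atTop_atTop.comp hn
  rw [tendsto_iff_norm_sub_tendsto_zero]
  refine squeeze_zero' (Eventually.of_forall fun i => norm_nonneg _)
    (g := fun i => 20000 * |t| ^ 3 / √(n i) + t ^ 2 / (4 * l i) + t ^ 4 / (4 * n i)) ?_ ?_
  · filter_upwards [hn.eventually_ge_atTop 1, hl.eventually_ge_atTop 1,
      hn'.eventually_ge_atTop (t ^ 2)] with i h1 h2 h3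
    exact norm_charFun_map_score_sub_le h1 h2 h3
  · have t1 : Tendsto (fun i => 20000 * |t| ^ 3 / √(n i)) F (𝓝 0) :=
      (Real.tendsto_sqrt_atTop.comp hn').const_div_atTop _
    have t2 : Tendsto (fun i => t ^ 2 / (4 * l i)) F (𝓝 0) :=
      (hl.const_mul_atTop (by norm_num)).const_div_atTop _
    have t3 : Tendsto (fun i => t ^ 4 / (4 * (n i : ℝ))) F (𝓝 0) :=
      (hn'.const_mul_atTop (by norm_num)).const_div_atTop _
    simpa using (t1.add t2).add t3

/-- Central limit theorem for the normalised sums of squared increments. -/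
lemma tendsto_integral_score [F.IsCountablyGenerated] (hn : Tendsto n F atTop)
    (hl : Tendsto l F atTop) (g : ℝ →ᵇ ℝ) :
    Tendsto (fun i => ∫ y, g (score (l i) y) ∂(productLaw (n i) (l i))) F
      (𝓝 (∫ y, g y ∂(gaussianReal 0 1))) := by
  -- Nonnegativity is needed at every index for the laws to be probability measures; eventually it
  -- holds anyway. Convergence is then tested along sequences, where Lévy's continuity theorem
  -- applies.
  wlog hl0 : ∀ i, 0 ≤ l i generalizing l
  · have hev : ∀ᶠ i in F, max (l i) 0 = l i := by
      filter_upwards [hl.eventually_ge_atTop 0] with i hi using max_eq_left hi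
    refine (this (l := fun i => max (l i) 0) (hl.congr' (hev.mono fun i hi => hi.symm))
      fun i => le_max_right _ _).congr' ?_
    filter_upwards [hev] with i hi
    rw [hi]
  refine tendsto_of_seq_tendsto fun k hk => ?_
  have hprob : ∀ i, IsProbabilityMeasure ((productLaw (n i) (l i)).map (score (l i))) := fun i =>
    have := isProbabilityMeasure_productLaw (n i) (hl0 i)
    Measure.isProbabilityMeasure_map Measurable.of_discrete.aemeasurable
  let μ : ℕ → ProbabilityMeasure ℝ := fun j =>
    ⟨(productLaw (n (k j)) (l (k j))).map (score (l (k j))), hprob _⟩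
  let μ₀ : ProbabilityMeasure ℝ := ⟨gaussianReal 0 1, inferInstance⟩
  have h : Tendsto μ atTop (𝓝 μ₀) := by
    refine ProbabilityMeasure.tendsto_iff_tendsto_charFun.2 fun t => ?_
    have := tendsto_charFun_map_score (hn.comp hk) (hl.comp hk) t
    simpa [μ, μ₀, charFun_gaussianReal, neg_div] using this
  have h2 := ProbabilityMeasure.tendsto_iff_forall_integral_tendsto.1 h g
  refine h2.congr fun j => ?_
  exact integral_map Measurable.of_discrete.aemeasurable
    g.continuous.aestronglyMeasurable

end CentralLimit

/-! ### Expansion of the log-likelihood ratio -/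

section Remainder

lemma log_gaussDensity {l : ℝ} (hl : 0 < l) (y : ℝ) :
    Real.log (gaussDensity l y) = -(y ^ 2 / (2 * l)) - Real.log (2 * Real.pi * l) / 2 := by
  rw [gaussDensity, Real.log_div (Real.exp_pos _).ne' (by positivity), Real.log_exp,
    Real.log_sqrt (by positivity)]

lemma log_gaussDensity_sub {l h : ℝ} (hl : 0 < l) (hh : 0 < 1 + h) (y : ℤ) :
    Real.log (gaussDensity ((1 + h) * l) y) - Real.log (gaussDensity l y)
      = h / (2 * (1 + h)) * (√2 * stdSq l y + 1) - Real.log (1 + h) / 2 := by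
  rw [log_gaussDensity (by positivity), log_gaussDensity hl]
  have e1 : Real.log (2 * Real.pi * ((1 + h) * l))
      = Real.log (1 + h) + Real.log (2 * Real.pi * l) := by
    rw [← Real.log_mul hh.ne' (by positivity)]; congr 1; ring
  have e2 : √2 * stdSq l y + 1 = (y : ℝ) ^ 2 / l := by
    rw [stdSq]; field_simp; ring
  rw [e1, e2]
  field_simp
  ring

/-- The first-order terms of `h / (1 + h)` and `log (1 + h)` cancel, leaving `-h² / 2`. Multiplied
by `n / 2`, with `n h² → 2 v²`, this is the source of `-v² / 2`. -/
lemma abs_div_one_add_sub_log_le {h : ℝ} (hh : |h| ≤ 1 / 2) :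
    |h / (1 + h) - Real.log (1 + h) + h ^ 2 / 2| ≤ 4 * |h| ^ 3 := by
  have h0 := abs_le.1 hh
  have hp : 0 < 1 + h := by linarith
  have h1 := Real.abs_log_sub_add_sum_range_le (x := -h) (by rw [abs_neg]; linarith) 2
  rw [abs_neg] at h1
  have h2 : |h| ^ 3 / (1 - |h|) ≤ 2 * |h| ^ 3 := by
    rw [div_le_iff₀ (by linarith)]
    have := pow_nonneg (abs_nonneg h) 3
    nlinarith
  have e1 : ∑ i ∈ Finset.range 2, (-h) ^ (i + 1) / ((i : ℝ) + 1) + Real.log (1 - -h)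
      = -h + h ^ 2 / 2 + Real.log (1 + h) := by
    simp [Finset.sum_range_succ]; ring
  rw [e1] at h1
  have h3 : |h ^ 3 / (1 + h)| ≤ 2 * |h| ^ 3 := by
    rw [abs_div, abs_pow, abs_of_pos hp, div_le_iff₀ hp]
    have := pow_nonneg (abs_nonneg h) 3
    nlinarith
  have e2 : h / (1 + h) - Real.log (1 + h) + h ^ 2 / 2
      = h ^ 3 / (1 + h) - (-h + h ^ 2 / 2 + Real.log (1 + h)) := by
    field_simp; ring
  rw [e2]
  refine (abs_sub _ _).trans ?_
  linarith [h1.trans h2]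

/-- The logarithm of the likelihood ratio of `n` independent increments. -/
noncomputable def logLikelihoodRatio {n : ℕ} (l l' : ℝ) (y : Fin n → ℤ) : ℝ :=
  ∑ j, (Real.log (incrProb l' (y j)) - Real.log (incrProb l (y j)))

/-- Inserting both Gaussian densities splits the remainder into local limit errors, the error in the
coefficient of the score and a deterministic error. The first is `n` times `(1200 + 1000) n³ / l`.
-/
lemma abs_remainder_le {n : ℕ} {l h : ℝ} (v : ℝ) (hn : 1 ≤ n) (hl : 0 < l) (hh : |h| ≤ 1 / 6)
    (hnl : 2000 * (n : ℝ) ^ 4 ≤ l) {y : Fin n → ℤ}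
    (hy : ∀ j, (y j : ℝ) ^ 2 ≤ 5 * Real.log n * l) :
    |logLikelihoodRatio l ((1 + h) * l) y - v * score l y + v ^ 2 / 2|
      ≤ 2200 * (n : ℝ) ^ 4 / l + |(h * √n * (√2 / (2 * (1 + h))) - v) * score l y|
        + |n * (h / (1 + h) - Real.log (1 + h)) / 2 + v ^ 2 / 2| := by
  have h0 := abs_le.1 hh
  have hp : 0 < 1 + h := by linarith
  have hn1 : (1 : ℝ) ≤ n := by exact_mod_cast hn
  have hn0 : (0 : ℝ) < n := by linarith
  have hlog : 0 ≤ Real.log n := Real.log_nonneg hn1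
  have hn34 : (n : ℝ) ^ 3 ≤ (n : ℝ) ^ 4 := pow_le_pow_right₀ hn1 (by norm_num)
  have hn3 : (1 : ℝ) ≤ (n : ℝ) ^ 3 := one_le_pow₀ hn1
  set l' := (1 + h) * l with hl'
  -- This is where `|h| ≤ 1 / 6` enters: the cutoff `5 l log n` stays within the range `6 l' log n`
  -- of the local limit estimate at the perturbed parameter.
  have hll : 5 * l ≤ 6 * l' := by rw [hl']; nlinarith
  have hl'0 : 0 < l' := by positivity
  have b1 : ∀ j, |Real.log (incrProb l' (y j)) - Real.log (gaussDensity l' (y j))|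
      ≤ 1000 * (n : ℝ) ^ 3 / l' := fun j =>
    abs_log_incrProb_sub_log_gaussDensity_le (by linarith) hn1 (by linarith) (by
      refine (hy j).trans ?_
      nlinarith)
  have b2 : ∀ j, |Real.log (incrProb l (y j)) - Real.log (gaussDensity l (y j))|
      ≤ 1000 * (n : ℝ) ^ 3 / l := fun j =>
    abs_log_incrProb_sub_log_gaussDensity_le (by linarith) hn1 (by linarith) (by
      refine (hy j).trans ?_
      nlinarith)
  have b3 : 1000 * (n : ℝ) ^ 3 / l' ≤ 1200 * (n : ℝ) ^ 3 / l := by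
    rw [div_le_div_iff₀ hl'0 hl]
    nlinarith
  have e : logLikelihoodRatio l l' y - v * score l y + v ^ 2 / 2
      = ∑ j, ((Real.log (incrProb l' (y j)) - Real.log (gaussDensity l' (y j)))
          - (Real.log (incrProb l (y j)) - Real.log (gaussDensity l (y j))))
        + (h * √n * (√2 / (2 * (1 + h))) - v) * score l y
        + (n * (h / (1 + h) - Real.log (1 + h)) / 2 + v ^ 2 / 2) := by
    have e1 : ∑ j, (Real.log (gaussDensity l' (y j)) - Real.log (gaussDensity l (y j)))
        = h * √n * (√2 / (2 * (1 + h))) * score l y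
          + n * (h / (1 + h) - Real.log (1 + h)) / 2 := by
      simp only [hl', log_gaussDensity_sub hl hp]
      rw [Finset.sum_sub_distrib, ← Finset.mul_sum, Finset.sum_add_distrib, ← Finset.mul_sum]
      have hs : ∑ j, stdSq l (y j) = √n * score l y := by
        have : √(n : ℝ) ≠ 0 := (Real.sqrt_pos.2 hn0).ne'
        rw [score]; field_simp
      rw [hs]
      simp
      field_simp
      ring
    rw [logLikelihoodRatio]
    have e2 : ∑ j, (Real.log (incrProb l' (y j)) - Real.log (incrProb l (y j)))
        = ∑ j, ((Real.log (incrProb l' (y j)) - Real.log (gaussDensity l' (y j)))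
          - (Real.log (incrProb l (y j)) - Real.log (gaussDensity l (y j))))
        + ∑ j, (Real.log (gaussDensity l' (y j)) - Real.log (gaussDensity l (y j))) := by
      rw [← Finset.sum_add_distrib]
      exact Finset.sum_congr rfl fun j _ => by ring
    rw [e2, e1]
    ring
  rw [e]
  refine (abs_add_three _ _ _).trans ?_
  gcongr
  refine (Finset.abs_sum_le_sum_abs _ _).trans ?_
  have hsum : ∀ j ∈ Finset.univ, |(Real.log (incrProb l' (y j)) - Real.log (gaussDensity l' (y j)))
          - (Real.log (incrProb l (y j)) - Real.log (gaussDensity l (y j)))|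
      ≤ 2200 * (n : ℝ) ^ 3 / l := fun j _ => by
    refine (abs_sub _ _).trans (((add_le_add ((b1 j).trans b3) (b2 j))).trans_eq ?_)
    ring
  refine (Finset.sum_le_card_nsmul _ _ _ hsum).trans_eq ?_
  simp
  ring

variable {ι : Type*} {F : Filter ι} {n : ι → ℕ} {l h : ι → ℝ} {v : ℝ}

/-- The log-likelihood ratio is asymptotically equal to the Gaussian shift expression. -/
lemma tendsto_productLaw_remainder (hn : Tendsto n F atTop)
    (hl0 : ∀ᶠ i in F, 0 < l i) (hnl : Tendsto (fun i => (n i : ℝ) ^ 4 / l i) F (𝓝 0))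
    (hh : Tendsto (fun i => h i * √(n i)) F (𝓝 (v * √2))) {δ : ℝ} (hδ : 0 < δ) :
    Tendsto (fun i => productLaw (n i) (l i)
      {y | δ < |logLikelihoodRatio (l i) ((1 + h i) * l i) y - v * score (l i) y + v ^ 2 / 2|})
      F (𝓝 0) := by
  have hn' : Tendsto (fun i => (n i : ℝ)) F atTop := tendsto_natCast_atTop_atTop.comp hn
  have hsqrt : Tendsto (fun i => √(n i : ℝ)) F atTop := Real.tendsto_sqrt_atTop.comp hn'
  have hh0 : Tendsto h F (𝓝 0) := by
    refine (hh.div_atTop hsqrt).congr' ?_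
    filter_upwards [hsqrt.eventually_gt_atTop 0] with i hi
    field_simp
  have hnh : Tendsto (fun i => n i * h i ^ 2) F (𝓝 (2 * v ^ 2)) := by
    have := hh.pow 2
    rw [mul_pow, Real.sq_sqrt (by norm_num), mul_comm] at this
    refine this.congr fun i => ?_
    rw [mul_pow, Real.sq_sqrt (Nat.cast_nonneg _), mul_comm]
  have hc : Tendsto (fun i => h i * √(n i) * (√2 / (2 * (1 + h i))) - v) F (𝓝 0) := by
    have h1 : Tendsto (fun i => √2 / (2 * (1 + h i))) F (𝓝 (√2 / (2 * (1 + 0)))) :=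
      tendsto_const_nhds.div ((hh0.const_add 1).const_mul 2) (by norm_num)
    have h2 := (hh.mul h1).sub_const v
    convert! h2 using 2
    have : √2 * √2 = 2 := Real.mul_self_sqrt (by norm_num)
    linear_combination (-(v / 2)) * this
  have hd : Tendsto (fun i => n i * (h i / (1 + h i) - Real.log (1 + h i)) / 2 + v ^ 2 / 2) F
      (𝓝 0) := by
    have h1 : Tendsto (fun i => n i * (h i / (1 + h i) - Real.log (1 + h i) + h i ^ 2 / 2) / 2) F
        (𝓝 0) := by
      refine squeeze_zero_norm' (a := fun i => 2 * (n i * h i ^ 2 * |h i|)) ?_ ?_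
      · have : ∀ᶠ i in F, |h i| < 1 / 2 := by
          have := hh0.abs
          rw [abs_zero] at this
          exact this.eventually_lt_const (by norm_num)
        filter_upwards [this] with i hi
        have h2 := abs_div_one_add_sub_log_le hi.le
        rw [Real.norm_eq_abs, abs_div, abs_mul, abs_of_nonneg (Nat.cast_nonneg (n i) : (0 : ℝ) ≤ n i),
          abs_two, div_le_iff₀ (by norm_num)]
        refine (mul_le_mul_of_nonneg_left h2 (Nat.cast_nonneg _)).trans_eq ?_
        rw [pow_succ, sq_abs]
        ring
      · have := (hnh.mul hh0.abs).const_mul 2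
        simpa using this
    have h2 := (h1.sub (hnh.div_const 4)).add_const (v ^ 2 / 2)
    convert! h2 using 2
    · ring
    · ring
  have hdet : Tendsto (fun i => 2200 * (n i : ℝ) ^ 4 / l i
      + |n i * (h i / (1 + h i) - Real.log (1 + h i)) / 2 + v ^ 2 / 2|) F (𝓝 0) := by
    have := (hnl.const_mul 2200).add hd.abs
    simpa [mul_div_assoc] using this
  -- The two terms bound the probability of a large increment and of a deviation of the score term
  -- beyond `δ / 2`. Off these events the remaining errors are deterministic and eventually below `δ
  -- / 2`.
  refine tendsto_of_tendsto_of_tendsto_of_le_of_le' tendsto_const_nhds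
    (h := fun i => ENNReal.ofReal (2 * (n i : ℝ) ^ (-(1 / 4) : ℝ))
      + ENNReal.ofReal ((h i * √(n i) * (√2 / (2 * (1 + h i))) - v) ^ 2 * 2 / (δ / 2) ^ 2)) ?_
    (Eventually.of_forall fun _ => zero_le) ?_
  · have t1 : Tendsto (fun i => 2 * (n i : ℝ) ^ (-(1 / 4) : ℝ)) F (𝓝 (2 * 0)) :=
      ((tendsto_rpow_neg_atTop (by norm_num)).comp hn').const_mul 2
    have t2 := ((hc.pow 2).mul_const 2).div_const ((δ / 2) ^ 2)
    have := (ENNReal.tendsto_ofReal t1).add (ENNReal.tendsto_ofReal t2)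
    simpa using this
  · have hhs : ∀ᶠ i in F, |h i| < 1 / 6 := by
      have := hh0.abs
      rw [abs_zero] at this
      exact this.eventually_lt_const (by norm_num)
    filter_upwards [hl0, hn.eventually_ge_atTop 1, hhs, hdet.eventually_lt_const (half_pos hδ),
      hnl.eventually_lt_const (by norm_num : (0 : ℝ) < 1 / 2000)] with i hli hni hhi hdi hnli
    have hn1 : (1 : ℝ) ≤ n i := by exact_mod_cast hni
    have hn4 : 2000 * (n i : ℝ) ^ 4 ≤ l i := by
      rw [div_lt_iff₀ hli] at hnli
      linarith
    have hn14 : (n i : ℝ) ≤ (n i : ℝ) ^ 4 := le_self_pow₀ hn1 (by norm_num)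
    have hlogn : Real.log (n i) ≤ n i := by
      have := Real.log_le_sub_one_of_pos (by linarith : (0 : ℝ) < n i)
      linarith
    have hprob := isProbabilityMeasure_productLaw (n i) hli.le
    have m1 := productLaw_real_exists_large_le hli hni (by linarith)
    have m2 := productLaw_score_ge_le (n := n i) (l := l i) (by linarith) hni (half_pos hδ)
      (h i * √(n i) * (√2 / (2 * (1 + h i))) - v)
    refine (measure_mono (t := {y | ∃ j, 5 * Real.log (n i) * l i < (y j : ℝ) ^ 2} ∪
      {y | δ / 2 ≤ |(h i * √(n i) * (√2 / (2 * (1 + h i))) - v) * score (l i) y|}) ?_).trans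
      ((measure_union_le _ _).trans (add_le_add ?_ m2))
    · intro y hy
      by_contra hcon
      rw [Set.mem_union, not_or] at hcon
      obtain ⟨c1, c2⟩ := hcon
      have c1' : ∀ j, (y j : ℝ) ^ 2 ≤ 5 * Real.log (n i) * l i := fun j => by
        by_contra hj
        exact c1 ⟨j, not_le.1 hj⟩
      have c2' : |(h i * √(n i) * (√2 / (2 * (1 + h i))) - v) * score (l i) y| < δ / 2 :=
        not_le.1 c2
      have hy' : δ < |logLikelihoodRatio (l i) ((1 + h i) * l i) y - v * score (l i) y
        + v ^ 2 / 2| := hy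
      have := abs_remainder_le v hni hli hhi.le hn4 c1'
      linarith
    · rw [← ofReal_measureReal]
      exact ENNReal.ofReal_le_ofReal m1

end Remainder

/-! ### Likelihood ratio of the observations and the LAN property -/

section LAN

variable {Ω : Type*} [MeasurableSpace Ω]

lemma isProbabilityMeasure_observationLaw {P : Measure Ω} [IsProbabilityMeasure P] {ϑ : ℝ}
    (hϑ : 0 < ϑ) {X : ℝ≥0 → Ω → ℤ} (hX : IsBernoulliCompoundPoisson ϑ X P) (T : ℝ) {Δ : ℝ}
    (hΔ : 0 < Δ) : IsProbabilityMeasure (observationLaw P X T Δ) := by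
  constructor
  have := isProbabilityMeasure_productLaw ⌊T / Δ⌋₊ (l := ϑ * Δ) (by positivity)
  have h := congrArg (fun μ => μ Set.univ) (observationLaw_map_increments hϑ hX T hΔ)
  rw [Measure.map_apply Measurable.of_discrete MeasurableSet.univ, Set.preimage_univ] at h
  rw [h]
  exact this.measure_univ

lemma exp_logLikelihoodRatio {n : ℕ} {l l' : ℝ} (hl : 0 < l) (hl' : 0 < l') (y : Fin n → ℤ) :
    Real.exp (logLikelihoodRatio l l' y) = (∏ j, incrProb l' (y j)) / ∏ j, incrProb l (y j) := by
  rw [logLikelihoodRatio, Real.exp_sum, ← Finset.prod_div_distrib]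
  refine Finset.prod_congr rfl fun j _ => ?_
  rw [Real.exp_sub, Real.exp_log (incrProb_pos hl' _), Real.exp_log (incrProb_pos hl _)]

/-- The likelihood ratio of the discrete observations. -/
lemma rnDeriv_observationLaw {P P' : Measure Ω} [IsProbabilityMeasure P]
    [IsProbabilityMeasure P'] {ϑ ϑ' : ℝ} (hϑ : 0 < ϑ) (hϑ' : 0 < ϑ') {X X' : ℝ≥0 → Ω → ℤ}
    (hX : IsBernoulliCompoundPoisson ϑ X P) (hX' : IsBernoulliCompoundPoisson ϑ' X' P')
    (T : ℝ) {Δ : ℝ} (hΔ : 0 < Δ) :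
    ∀ᵐ x ∂(observationLaw P X T Δ),
      ((observationLaw P' X' T Δ).rnDeriv (observationLaw P X T Δ) x).toReal
        = Real.exp (logLikelihoodRatio (ϑ * Δ) (ϑ' * Δ) (increments x)) := by
  have := isProbabilityMeasure_observationLaw hϑ hX T hΔ
  have hl : 0 < ϑ * Δ := by positivity
  have hl' : 0 < ϑ' * Δ := by positivity
  -- On a countable space with strictly positive point masses the density is the ratio of the
  -- masses.
  have hd : observationLaw P' X' T Δ = (observationLaw P X T Δ).withDensity
      fun x => ENNReal.ofReal (Real.exp (logLikelihoodRatio (ϑ * Δ) (ϑ' * Δ) (increments x))) := by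
    refine Measure.ext_of_singleton fun x => ?_
    rw [withDensity_apply _ (measurableSet_singleton x), lintegral_singleton,
      observationLaw_singleton hϑ hX T hΔ, observationLaw_singleton hϑ' hX' T hΔ,
      exp_logLikelihoodRatio hl hl']
    have hpos : 0 < ∏ j, incrProb (ϑ * Δ) (increments x j) :=
      Finset.prod_pos fun j _ => incrProb_pos hl _
    rw [← ENNReal.ofReal_mul (div_nonneg (Finset.prod_nonneg fun j _ => incrProb_nonneg hl'.le _)
      hpos.le), div_mul_cancel₀ _ hpos.ne']
  have h := Measure.rnDeriv_withDensity (observationLaw P X T Δ)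
    (f := fun x => ENNReal.ofReal (Real.exp (logLikelihoodRatio (ϑ * Δ) (ϑ' * Δ) (increments x))))
    Measurable.of_discrete
  rw [← hd] at h
  filter_upwards [h] with x hx
  rw [hx, ENNReal.toReal_ofReal (Real.exp_pos _).le]

/-- The fourth power of the rate quantity is `(T / Δ)⁴ / Δ`. The logarithmic factor enters only
through its convergence to `0`. -/
lemma tendsto_floor_pow_four_div {Δ : ℝ → ℝ} (hΔ : ∀ T > 0, 0 < Δ T)
    (hn_top : Tendsto (fun T => T / Δ T) atTop atTop)
    (hrate : (fun T => T / Δ T ^ (1 + 1 / 4 : ℝ)) =o[atTop]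
      fun T => Real.log (T / Δ T) ^ (-(1 / 4) : ℝ)) :
    Tendsto (fun T => (⌊T / Δ T⌋₊ : ℝ) ^ 4 / Δ T) atTop (𝓝 0) := by
  have h1 : Tendsto (fun T => Real.log (T / Δ T) ^ (-(1 / 4) : ℝ)) atTop (𝓝 0) :=
    (tendsto_rpow_neg_atTop (by norm_num)).comp (Real.tendsto_log_atTop.comp hn_top)
  have h2 : Tendsto (fun T => (T / Δ T ^ (1 + 1 / 4 : ℝ)) ^ 4) atTop (𝓝 0) := by
    simpa using (hrate.isBigO.trans_tendsto h1).pow 4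
  refine squeeze_zero' ?_ ?_ h2
  · filter_upwards [eventually_gt_atTop 0] with T hT
    have := hΔ T hT
    positivity
  · filter_upwards [eventually_gt_atTop 0] with T hT
    have hd := hΔ T hT
    have e : (T / Δ T ^ (1 + 1 / 4 : ℝ)) ^ 4 = (T / Δ T) ^ 4 / Δ T := by
      have e5 : (Δ T ^ (1 + 1 / 4 : ℝ)) ^ 4 = Δ T ^ 5 := by
        rw [← Real.rpow_natCast, ← Real.rpow_mul hd.le, ← Real.rpow_natCast]
        norm_num
      rw [div_pow, e5, div_pow, div_div]
      ring
    rw [e]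
    gcongr
    exact Nat.floor_le (by positivity)

/-- The relative perturbation of `ϑ` is `h = v / (ϑ √I)`, and `n / (ϑ² I) → 2` by the choice of
information. Only the asymptotic equivalence class of `I` matters, so one argument serves both
claims of the theorem. -/
lemma tendsto_local_parameter_mul_sqrt {Δ I : ℝ → ℝ} {ϑ : ℝ} (hϑ : 0 < ϑ)
    (hn_top : Tendsto (fun T => T / Δ T) atTop atTop) (hI : ∀ T > 0, 0 < I T)
    (hequiv : I ~[atTop] macroInformation Δ ϑ) (v : ℝ) :
    Tendsto (fun T => v / (ϑ * √(I T)) * √(⌊T / Δ T⌋₊ : ℝ)) atTop (𝓝 (v * √2)) := by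
  have h1 : Tendsto (fun T => macroInformation Δ ϑ T / I T) atTop (𝓝 1) := by
    refine (isEquivalent_iff_tendsto_one ?_).1 hequiv.symm
    filter_upwards [eventually_gt_atTop 0] with T hT using (hI T hT).ne'
  have h2 : Tendsto (fun T => (⌊T / Δ T⌋₊ : ℝ) / (T / Δ T)) atTop (𝓝 1) :=
    tendsto_nat_floor_div_atTop.comp hn_top
  have h3 := (((h2.mul h1).const_mul 2).sqrt).const_mul v
  simp only [mul_one] at h3
  refine h3.congr' ?_
  filter_upwards [eventually_gt_atTop 0, hn_top.eventually_gt_atTop 0] with T hT hq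
  have hIT := hI T hT
  have e : 2 * ((⌊T / Δ T⌋₊ : ℝ) / (T / Δ T) * (macroInformation Δ ϑ T / I T))
      = (⌊T / Δ T⌋₊ : ℝ) / (ϑ ^ 2 * I T) := by
    rw [macroInformation, ← div_eq_mul_inv]
    generalize T / Δ T = q at *
    field_simp
  rw [e, Real.sqrt_div (Nat.cast_nonneg _), Real.sqrt_mul (by positivity), Real.sqrt_sq hϑ.le]
  ring

theorem isLANAt_of_isEquivalent {Θ : Set ℝ} (hΘ_pos : Θ ⊆ Set.Ioi 0)
    {P : ℝ → Measure Ω} [∀ ϑ, IsProbabilityMeasure (P ϑ)] {X : ℝ → ℝ≥0 → Ω → ℤ}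
    (hX : ∀ ϑ ∈ Θ, IsBernoulliCompoundPoisson ϑ (X ϑ) (P ϑ))
    {Δ : ℝ → ℝ} (hΔ : ∀ T > 0, 0 < Δ T) (hΔ_top : Tendsto Δ atTop atTop)
    (hn_top : Tendsto (fun T => T / Δ T) atTop atTop)
    (hrate : (fun T => T / Δ T ^ (1 + 1 / 4 : ℝ)) =o[atTop]
      fun T => Real.log (T / Δ T) ^ (-(1 / 4) : ℝ))
    {ϑ : ℝ} (hϑ : ϑ ∈ Θ) {I : ℝ → ℝ} (hI : ∀ T > 0, 0 < I T)
    (hequiv : I ~[atTop] macroInformation Δ ϑ) :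
    IsLANAt (fun T ϑ' => observationLaw (P ϑ') (X ϑ') T (Δ T)) Θ I ϑ := by
  have hϑ0 : 0 < ϑ := hΘ_pos hϑ
  have hn : Tendsto (fun T => ⌊T / Δ T⌋₊) atTop atTop := tendsto_nat_floor_atTop.comp hn_top
  have hl : Tendsto (fun T => ϑ * Δ T) atTop atTop := hΔ_top.const_mul_atTop hϑ0
  have hmap : ∀ T > 0, (observationLaw (P ϑ) (X ϑ) T (Δ T)).map increments
      = productLaw ⌊T / Δ T⌋₊ (ϑ * Δ T) := fun T hT =>
    observationLaw_map_increments hϑ0 (hX ϑ hϑ) T (hΔ T hT)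
  -- The remainder is defined as the exact difference, so the likelihood identity is immediate once
  -- the density is known.
  refine ⟨hI, fun T x => score (ϑ * Δ T) (increments x), fun T => Measurable.of_discrete,
    fun g => ?_, fun v => ⟨fun T x => logLikelihoodRatio (ϑ * Δ T) ((ϑ + v / √(I T)) * Δ T)
      (increments x) - v * score (ϑ * Δ T) (increments x) + v ^ 2 / 2,
      fun T => Measurable.of_discrete, fun T hT hv => ?_, fun δ hδ => ?_⟩⟩
  · refine (tendsto_integral_score hn hl g).congr' ?_
    filter_upwards [eventually_gt_atTop 0] with T hT
    rw [← hmap T hT, integral_map Measurable.of_discrete.aemeasurable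
      Measurable.of_discrete.aestronglyMeasurable]
  · filter_upwards [rnDeriv_observationLaw hϑ0 (hΘ_pos hv) (hX ϑ hϑ) (hX _ hv) T (hΔ T hT)]
      with x hx
    rw [hx]
    congr 1
    ring
  -- The explicit remainder makes sense even when the local alternative leaves `Θ`, so convergence
  -- is proved along all `T` and then restricted.
  · refine Tendsto.mono_left ?_ inf_le_left
    have hnl : Tendsto (fun T => (⌊T / Δ T⌋₊ : ℝ) ^ 4 / (ϑ * Δ T)) atTop (𝓝 0) := by
      have := (tendsto_floor_pow_four_div hΔ hn_top hrate).div_const ϑ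
      simpa only [div_div, mul_comm ϑ, zero_div] using this
    have hl0 : ∀ᶠ T in atTop, 0 < ϑ * Δ T := hl.eventually_gt_atTop 0
    refine (tendsto_productLaw_remainder hn hl0 hnl
      (tendsto_local_parameter_mul_sqrt hϑ0 hn_top hI hequiv v) hδ).congr' ?_
    filter_upwards [eventually_gt_atTop 0] with T hT
    have e : (1 + v / (ϑ * √(I T))) * (ϑ * Δ T) = (ϑ + v / √(I T)) * Δ T := by
      field_simp
    rw [← hmap T hT, Measure.map_apply Measurable.of_discrete (Set.to_countable _).measurableSet, e]
    rfl

end LAN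

theorem theorem3 {Ω : Type*} [MeasurableSpace Ω]
    (Θ : Set ℝ) (hΘ_pos : Θ ⊆ Set.Ioi 0) (_hΘ_int : (interior Θ).Nonempty)
    (P : ℝ → Measure Ω) [∀ ϑ, IsProbabilityMeasure (P ϑ)] (X : ℝ → ℝ≥0 → Ω → ℤ)
    (hX : ∀ ϑ ∈ Θ, IsBernoulliCompoundPoisson ϑ (X ϑ) (P ϑ))
    (Δ : ℝ → ℝ) (hΔ : ∀ T > 0, 0 < Δ T ∧ Δ T ≤ T)
    (hΔ_top : Tendsto Δ atTop atTop)
    (hn_top : Tendsto (fun T => T / Δ T) atTop atTop)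
    (hrate : (fun T => T / Δ T ^ (1 + 1 / 4 : ℝ)) =o[atTop]
      fun T => Real.log (T / Δ T) ^ (-(1 / 4) : ℝ))
    (ϑ : ℝ) (hϑ : ϑ ∈ Θ) :
    IsLANAt (fun T ϑ' => observationLaw (P ϑ') (X ϑ') T (Δ T)) Θ (macroInformation Δ ϑ) ϑ ∧
    ∀ I : ℝ → ℝ, (∀ T > 0, 0 < I T) → I ~[atTop] macroInformation Δ ϑ →
      IsLANAt (fun T ϑ' => observationLaw (P ϑ') (X ϑ') T (Δ T)) Θ I ϑ := by
  have hϑ0 : 0 < ϑ := hΘ_pos hϑ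
  refine ⟨isLANAt_of_isEquivalent hΘ_pos hX (fun T hT => (hΔ T hT).1) hΔ_top hn_top hrate hϑ
    (fun T hT => ?_) .refl, fun I hI hequiv => isLANAt_of_isEquivalent hΘ_pos hX
    (fun T hT => (hΔ T hT).1) hΔ_top hn_top hrate hϑ hI hequiv⟩
  have := (hΔ T hT).1
  unfold macroInformation
  positivity
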